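/- **Notation.** $\mathbb R^d$ carries the Euclidean norm, $\overline{\mathbf B_d}$ is its closed unit ball, and matrices carry the induced operator norm $\|\cdot\|$. For a square matrix $A$ put $m(A)=\sup_{\|z\|=1}\|Az\|$, $$l(A)=\lim_{h\to 0+}\frac{\|I+hA\|-1}{h},\qquad m_l(A)=\lim_{h\to 0+}\frac{\inf_{\|z\|=1}\|(I+hA)z\|-1}{h}=-l(-A).$$ On a $0$-dimensional space $l=-\infty$, $m_l=+\infty$, $m=0$. **Setting.** Let $K\subset\mathbb R^k$ be compact and $f=(f^a,f^b):\mathbb R^{n_u}\times\mathbb R^{n_s}\times\mathbb R^k\to\mathbb R^{n_u}\times\mathbb R^{n_s}$ be $C^\infty$; consider $$\dot a=f^a(a,b;\mu),\qquad \dot b=f^b(a,b;\mu). \tag{1}$$ Let $n=n_u+n_s$. For $\mu\in K$ let $P_\mu:\mathbb R^{n_u}\times\mathbb R^{n_s}\to\mathbb R^{n}$ be a $C^\infty$ diffeomorphism, let $N=N_\mu=P_\mu(\overline{\mathbf B_{n_u}}\times\overline{\mathbf B_{n_s}})$, and let $\dot x=F(x;\mu)$ be a differential equation on $\mathbb R^n$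 whose expression on $N$ in the coordinates $x=P_\mu(a,b)$ is (1), i.e. $DP_\mu(z)f(z;\mu)=F(P_\mu(z);\mu)$ for $z\in\overline{\mathbf B_{n_u}}\times\overline{\mathbf B_{n_s}}$. Let $x_*(\mu)=P_\mu(0,0)$ be an equilibrium, $F(x_*(\mu);\mu)=0$, for every $\mu\in K$. Write $W^u(x_*(\mu))\cap N$ for the (local) unstable manifold in $N$: the set of $x_0$ for which there is a solution $x(\tau)$, $\tau\le 0$, of $\dot x=F(x;\mu)$ with $x(0)=x_0$, $x(\tau)\in N$ for all $\tau\le0$, and $x(\tau)\to x_*(\mu)$ as $\tau\to-\infty$. Let $M>1$. Suprema and infima below are over $(z,\mu)\in \overline{\mathbf B_{n_u}}\times\overline{\mathbf B_{n_s}}\times K$, at which the derivatives are evaluated: $$\mu_s=\sup\Big\{l\big(\tfrac{\partial f^b}{\partial b}\big)+M\big\|\tfrac{\partial f^b}{\partial(a,\mu)}\big\|\Big\},\qquad \xi_u=\inf m_l\big(\tfrac{\partial f^a}{\partial a}\big)-M\sup\big\|\tfrac{\partial f^a}{\partial(b,\mu)}\big\|,$$ $$\mu_{ss}=\sup\Big\{l\big(\tfrac{\partial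 f^b}{\partial b}\big)+\tfrac1M\big\|\tfrac{\partial f^b}{\partial a}\big\|\Big\},\qquad \xi_{su}=\inf m_l\big(\tfrac{\partial f^a}{\partial a}\big)-\tfrac1M\sup\big\|\tfrac{\partial f^a}{\partial b}\big\|.$$ **Proposition (Lyapunov functions on unstable manifolds).** Assume the $M$-cone condition $$\mu_s<0<\xi_u,\qquad \mu_{ss}<\xi_u,\qquad \mu_s<\xi_{su},$$ and $$\xi_{u,W^u}:=\inf\Big\{m_l\big(\tfrac{\partial f^a}{\partial a}\big)-\tfrac{M^2+1}{M^3}\big\|\tfrac{\partial f^a}{\partial b}\big\|-\tfrac1{M^2}\,m\big(\tfrac{\partial f^a}{\partial a}\big)\Big\}>0 .$$ Then for every $\mu\in K$ there is a function $\sigma^u_\mu:\overline{\mathbf B_{n_u}}\to\overline{\mathbf B_{n_s}}$, Lipschitz with constant $1/M$, such that $$W^u(x_*(\mu))\cap N=\{P_\mu(a,\sigma^u_\mu(a)) : a\in\overline{\mathbf B_{n_u}}\},$$ and $$L_u(a,b;\mu)=-\big(\|a\|^2+\|\sigma^u_\mu(a)\|^2\big)$$ (as a function of $x=P_\mu(a,b)$)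 is a Lyapunov function on $W^u(x_*(\mu))\cap N$: for every solution $x(\tau)$ of $\dot x=F(x;\mu)$ defined on a nondegenerate interval $J$ with values in $W^u(x_*(\mu))\cap N$ and every $\tau\in J$, the derivative $\frac{d}{d\tau}L_u(x(\tau))$ exists (one-sided at an end point belonging to $J$), is $\le 0$, and is $0$ only if $x(\tau)=x_*(\mu)$. Moreover $\tilde L_u=-L_u$ satisfies along every such solution $$\frac12\frac{d}{d\tau}\tilde L_u(x(\tau))\ \ge\ \frac{M^2}{M^2+1}\,\xi_{u,W^u}\,\tilde L_u(x(\tau)).$$ -/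

import Mathlib

open Set Filter Topology
open scoped ContDiff

noncomputable section

/-- The space `ℝ^d` with its Euclidean norm. -/
abbrev Euc (d : ℕ) : Type := EuclideanSpace ℝ (Fin d)

section LogarithmicNorms

variable {E : Type*} [NormedAddCommGroup E] [NormedSpace ℝ E]

/-- The logarithmic norm `l(A) = lim_{h → 0+} (‖I + hA‖ - 1) / h`. The limit always exists in
`[-∞, ∞]` (the quotient is monotone in `h > 0`), so it equals the upper limit written here. It is
real unless `E` is trivial, where it is `-∞`. -/
def logNorm (A : E →L[ℝ] E) : EReal :=
  limsup (fun h : ℝ => (((‖1 + h • A‖ - 1) / h : ℝ) : EReal)) (𝓝[>] 0)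

/-- The minimal expansion `inf {‖A z‖ : ‖z‖ = 1}`, which is `+∞` if there is no unit vector. -/
def minExpansion (A : E →L[ℝ] E) : EReal :=
  ⨅ z ∈ {z : E | ‖z‖ = 1}, ((‖A z‖ : ℝ) : EReal)

/-- The logarithmic minimum `m_l(A) = lim_{h → 0+} (inf {‖(I + hA) z‖ : ‖z‖ = 1} - 1) / h`. The
limit always exists in `[-∞, ∞]` and equals `-l(-A)`. It is real unless `E` is trivial,
where it is `+∞`. -/
def logMin (A : E →L[ℝ] E) : EReal :=
  limsup (fun h : ℝ => (minExpansion (1 + h • A) - 1) / (h : EReal)) (𝓝[>] 0)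

end LogarithmicNorms

section Dynamics

variable {E : Type*} [NormedAddCommGroup E] [NormedSpace ℝ E]

/-- `W^u(p) ∩ N` for the equation `x' = v x`: the points of `N` from which a backward trajectory
starts that exists for all `t ≤ 0`, stays in `N`, and converges to `p` as `t → -∞`. -/
def unstableManifoldIn (v : E → E) (p : E) (N : Set E) : Set E :=
  {x₀ | ∃ x : ℝ → E, x 0 = x₀ ∧ IsIntegralCurveOn x (fun _ => v) (Iic 0) ∧
    MapsTo x (Iic 0) N ∧ Tendsto x atBot (𝓝 p)}

/-- `L` is a Lyapunov function on `S` for the equation `x' = v x` with equilibrium `p`: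
along every trajectory in `S`, defined on an interval `J`, the derivative of `L` exists
(one-sided at an end point of `J`), is nonpositive, and vanishes only at `p`. -/
def IsLyapunovOn (v : E → E) (p : E) (S : Set E) (L : E → ℝ) : Prop :=
  ∀ (J : Set ℝ) (x : ℝ → E), J.OrdConnected → J.Nontrivial →
    IsIntegralCurveOn x (fun _ => v) J → MapsTo x J S →
    ∀ t ∈ J, ∃ D : ℝ, HasDerivWithinAt (fun s => L (x s)) D J t ∧ D ≤ 0 ∧ (D = 0 → x t = p)

end Dynamics

section ConeCondition

variable {nu ns k : ℕ}

/-- The product of closed unit balls, i.e. the set `c_N(N)` in the coordinates `(a, b)`. -/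
def unitBox (nu ns : ℕ) : Set (Euc nu × Euc ns) :=
  Metric.closedBall 0 1 ×ˢ Metric.closedBall 0 1

variable (f : (Euc nu × Euc ns) × Euc k → Euc nu × Euc ns)

/-- `∂f^a/∂a` at `(z; μ)`. -/
def dfaa (z : Euc nu × Euc ns) (μ : Euc k) : Euc nu →L[ℝ] Euc nu :=
  fderiv ℝ (fun a : Euc nu => (f ((a, z.2), μ)).1) z.1

/-- `∂f^a/∂b` at `(z; μ)`. -/
def dfab (z : Euc nu × Euc ns) (μ : Euc k) : Euc ns →L[ℝ] Euc nu :=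
  fderiv ℝ (fun b : Euc ns => (f ((z.1, b), μ)).1) z.2

/-- `∂f^b/∂a` at `(z; μ)`. -/
def dfba (z : Euc nu × Euc ns) (μ : Euc k) : Euc nu →L[ℝ] Euc ns :=
  fderiv ℝ (fun a : Euc nu => (f ((a, z.2), μ)).2) z.1

/-- `∂f^b/∂b` at `(z; μ)`. -/
def dfbb (z : Euc nu × Euc ns) (μ : Euc k) : Euc ns →L[ℝ] Euc ns :=
  fderiv ℝ (fun b : Euc ns => (f ((z.1, b), μ)).2) z.2

/-- `∂f^a/∂(b, μ)` at `(z; μ)`, on `ℝ^{n_s} × ℝ^k` with the Euclidean norm. -/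
def dfabμ (z : Euc nu × Euc ns) (μ : Euc k) : WithLp 2 (Euc ns × Euc k) →L[ℝ] Euc nu :=
  fderiv ℝ (fun q : WithLp 2 (Euc ns × Euc k) => (f ((z.1, q.fst), q.snd)).1)
    (WithLp.toLp 2 (z.2, μ))

/-- `∂f^b/∂(a, μ)` at `(z; μ)`, on `ℝ^{n_u} × ℝ^k` with the Euclidean norm. -/
def dfbaμ (z : Euc nu × Euc ns) (μ : Euc k) : WithLp 2 (Euc nu × Euc k) →L[ℝ] Euc ns :=
  fderiv ℝ (fun q : WithLp 2 (Euc nu × Euc k) => (f ((q.fst, z.2), q.snd)).2)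
    (WithLp.toLp 2 (z.1, μ))

variable (K : Set (Euc k)) (M : ℝ)

/-- The rate `μ_s`. -/
def rateMuS : EReal :=
  ⨆ z ∈ unitBox nu ns, ⨆ μ ∈ K, (logNorm (dfbb f z μ) + ((M * ‖dfbaμ f z μ‖ : ℝ) : EReal))

/-- The rate `ξ_u`. -/
def rateXiU : EReal :=
  (⨅ z ∈ unitBox nu ns, ⨅ μ ∈ K, logMin (dfaa f z μ)) -
    (M : EReal) * ⨆ z ∈ unitBox nu ns, ⨆ μ ∈ K, ((‖dfabμ f z μ‖ : ℝ) : EReal)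

/-- The rate `μ_ss`. -/
def rateMuSS : EReal :=
  ⨆ z ∈ unitBox nu ns, ⨆ μ ∈ K, (logNorm (dfbb f z μ) + ((1 / M * ‖dfba f z μ‖ : ℝ) : EReal))

/-- The rate `ξ_su`. -/
def rateXiSU : EReal :=
  (⨅ z ∈ unitBox nu ns, ⨅ μ ∈ K, logMin (dfaa f z μ)) -
    ((1 / M : ℝ) : EReal) * ⨆ z ∈ unitBox nu ns, ⨆ μ ∈ K, ((‖dfab f z μ‖ : ℝ) : EReal)

/-- The `M`-cone condition of the vector field `f = (f^a, f^b)` in `N × K`. -/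
structure MConeCondition : Prop where
  muS_neg : rateMuS f K M < 0
  xiU_pos : 0 < rateXiU f K M
  muSS_lt_xiU : rateMuSS f K M < rateXiU f K M
  muS_lt_xiSU : rateMuS f K M < rateXiSU f K M

/-- The rate `ξ_{u,W^u}`; the operator norm in the last term is
`m(∂f^a/∂a) = sup {‖(∂f^a/∂a) z‖ : ‖z‖ = 1}`. -/
def rateXiUWu : EReal :=
  ⨅ z ∈ unitBox nu ns, ⨅ μ ∈ K,
    (logMin (dfaa f z μ) - (((M ^ 2 + 1) / M ^ 3 * ‖dfab f z μ‖ : ℝ) : EReal)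
      - ((1 / M ^ 2 * ‖dfaa f z μ‖ : ℝ) : EReal))

end ConeCondition

/-- The function `L_u(a, b) = -(‖a‖² + ‖σ a‖²)` of the coordinates `(a, b)`. -/
def lyapunovU {nu ns : ℕ} (σ : Euc nu → Euc ns) (z : Euc nu × Euc ns) : ℝ :=
  -(‖z.1‖ ^ 2 + ‖σ z.1‖ ^ 2)

end

/-! By the mean value theorem, `μ_s < 0 < ξ_u` says that differences `(Δa, Δb)` of points of the box
expand in `a` when `‖Δb‖ ≤ M‖Δa‖` and contract in `b` when `‖Δa‖ ≤ M‖Δb‖` (`IsConeField`,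
`exists_isConeField`). Both apply where `‖Δa‖ = M‖Δb‖`, so the cone `M‖Δb‖ ≤ ‖Δa‖` is forward
invariant (`cone_forward`). Two orbits in the box for all negative times differ by a vector of this
cone, since otherwise `‖Δb‖` would grow exponentially backward (`cone_of_backward`). Hence such
orbits fill at most a `1/M`-Lipschitz graph. Comparison with the equilibrium makes them converge to
it, so their points are exactly `W^u ∩ N`.

The graph covers the whole ball by a graph transform: the time-`h` flow maps a `1/M`-Lipschitz graph
onto another one, and `n` steps give orbits that stay in the box for time `nh` over every `a₀`. A
limit of these is a full backward orbit (`exists_backward`).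

On the graph the velocity is a limit of difference quotients from the cone, so `M‖f^b‖ ≤ ‖f^a‖`
without any differentiability of `σ` (`mul_norm_snd_deriv_le`). Then `⟪a, f^a⟫ + ⟪b, f^b⟫ ≥ ⟪a, f^a⟫
- ‖a‖‖f^a‖/M²`, which a single application of the mean value theorem bounds below by `ξ_{u,W^u}‖a‖²`
(`le_inner_add_inner_of_cone`). Finally `‖a‖² ≥ M²/(M²+1) (‖a‖² + ‖b‖²)` on the cone. -/

open scoped NNReal RealInnerProductSpace


/-! ### Global solutions of Lipschitz differential equations -/

section GlobalCurves

variable {X : Type*} [NormedAddCommGroup X] [NormedSpace ℝ X] {v : X → X} {L : ℝ≥0}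

theorem dist_le_exp_of_isIntegralCurve_of_le (hv : LipschitzWith L v) {γ δ : ℝ → X}
    (hγ : IsIntegralCurve γ fun _ => v) (hδ : IsIntegralCurve δ fun _ => v) {s t : ℝ}
    (hst : s ≤ t) :
    dist (γ t) (δ t) ≤ dist (γ s) (δ s) * Real.exp (L * (t - s)) :=
  dist_le_of_trajectories_ODE (fun _ => hv) hγ.continuous.continuousOn
    (fun r _ => (hγ r).hasDerivWithinAt) hδ.continuous.continuousOn
    (fun r _ => (hδ r).hasDerivWithinAt) le_rfl t ⟨hst, le_rfl⟩

theorem IsIntegralCurve.comp_neg_time {γ : ℝ → X} (hγ : IsIntegralCurve γ fun _ => v) :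
    IsIntegralCurve (fun t => γ (-t)) fun _ x => -v x := fun t => by
  simpa using! (hγ (-t)).scomp t (hasDerivAt_neg t)

theorem IsIntegralCurve.comp_add_const {γ : ℝ → X} (hγ : IsIntegralCurve γ fun _ => v) (h : ℝ) :
    IsIntegralCurve (fun t => γ (t + h)) fun _ => v := fun t =>
  (hγ (t + h)).comp_add_const t h

theorem dist_le_exp_of_isIntegralCurve (hv : LipschitzWith L v) {γ δ : ℝ → X}
    (hγ : IsIntegralCurve γ fun _ => v) (hδ : IsIntegralCurve δ fun _ => v) (s t : ℝ) :
    dist (γ t) (δ t) ≤ dist (γ s) (δ s) * Real.exp (L * |t - s|) := by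
  rcases le_total s t with hst | hst
  · rw [abs_of_nonneg (sub_nonneg.2 hst)]
    exact dist_le_exp_of_isIntegralCurve_of_le hv hγ hδ hst
  · have := dist_le_exp_of_isIntegralCurve_of_le (v := fun x => -v x) hv.neg hγ.comp_neg_time
      hδ.comp_neg_time (neg_le_neg hst)
    simp only [neg_neg] at this
    rwa [abs_of_nonpos (sub_nonpos.2 hst), neg_sub, show s - t = -t - -s by ring]

theorem IsIntegralCurve.eq_of_eq_at (hv : LipschitzWith L v) {γ δ : ℝ → X}
    (hγ : IsIntegralCurve γ fun _ => v) (hδ : IsIntegralCurve δ fun _ => v) {s : ℝ}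
    (h : γ s = δ s) (t : ℝ) : γ t = δ t := by
  have := dist_le_exp_of_isIntegralCurve hv hγ hδ s t
  rw [h, dist_self, zero_mul] at this
  exact dist_le_zero.1 this

/-- Boundedness lets Picard–Lindelöf run on `[-(n+1), n+1]` in a ball of radius `C(n+1)`, which a
solution cannot leave in that time; the pieces are glued by uniqueness. -/
theorem exists_isIntegralCurve_of_lipschitz_of_bounded [CompleteSpace X] (hv : LipschitzWith L v)
    {C : ℝ≥0} (hC : ∀ x, ‖v x‖ ≤ C) (x : X) :
    ∃ γ : ℝ → X, γ 0 = x ∧ IsIntegralCurve γ fun _ => v := by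
  have key : ∀ n : ℕ, ∃ α : ℝ → X, α 0 = x ∧
      ∀ t ∈ Icc (-(n + 1 : ℝ)) (n + 1), HasDerivWithinAt α (v (α t)) (Icc (-(n + 1 : ℝ)) (n + 1)) t := by
    intro n
    have hn : (0 : ℝ) ≤ n := n.cast_nonneg
    have hpl : IsPicardLindelof (fun _ => v) (tmin := -(n + 1 : ℝ)) (tmax := n + 1)
        ⟨0, by constructor <;> linarith⟩ x (C * (n + 1)) 0 C L :=
      IsPicardLindelof.of_time_independent (fun y _ => hC y) hv.lipschitzOnWith (by simp)
    exact hpl.exists_eq_forall_mem_Icc_hasDerivWithinAt₀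
  choose α hα0 hα using key
  have hd : ∀ n : ℕ, ∀ t ∈ Ioo (-(n + 1 : ℝ)) (n + 1), HasDerivAt (α n) (v (α n t)) t :=
    fun n t ht => (hα n t (Ioo_subset_Icc_self ht)).hasDerivAt (Icc_mem_nhds ht.1 ht.2)
  have hagree : ∀ m n : ℕ, m ≤ n → ∀ t ∈ Ioo (-(m + 1 : ℝ)) (m + 1), α m t = α n t := by
    intro m n hmn
    have hmn' : (m : ℝ) ≤ n := by exact_mod_cast hmn
    have hm : (0 : ℝ) ≤ m := m.cast_nonneg
    refine ODE_solution_unique_of_mem_Ioo (v := fun _ => v) (s := fun _ => univ) (t₀ := 0) (K := L)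
      (fun _ _ => hv.lipschitzOnWith) ⟨by linarith, by linarith⟩
      (fun t ht => ⟨hd m t ht, trivial⟩)
      (fun t ht => ⟨hd n t ⟨by linarith [ht.1], by linarith [ht.2]⟩, trivial⟩) (by simp [hα0])
  have hglue : ∀ n : ℕ, ∀ t ∈ Ioo (-(n + 1 : ℝ)) (n + 1), α ⌈|t|⌉₊ t = α n t := by
    intro n t ht
    have h1 : t ∈ Ioo (-((⌈|t|⌉₊ : ℕ) + 1 : ℝ)) ((⌈|t|⌉₊ : ℕ) + 1) := by
      rw [mem_Ioo, ← abs_lt]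
      linarith [Nat.le_ceil |t|]
    rcases le_total ⌈|t|⌉₊ n with h | h
    · exact hagree _ _ h t h1
    · exact (hagree _ _ h t ht).symm
  refine ⟨fun t => α ⌈|t|⌉₊ t, by simp [hα0], fun t => ?_⟩
  have h1 : t ∈ Ioo (-((⌈|t|⌉₊ : ℕ) + 1 : ℝ)) ((⌈|t|⌉₊ : ℕ) + 1) := by
    rw [mem_Ioo, ← abs_lt]
    linarith [Nat.le_ceil |t|]
  refine (hd _ t h1).congr_of_eventuallyEq ?_
  filter_upwards [Ioo_mem_nhds h1.1 h1.2] with s hs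
  exact hglue _ s hs

end GlobalCurves

/-! ### Radial retraction onto the unit ball -/

section Clamp

variable {E : Type*} [NormedAddCommGroup E] [NormedSpace ℝ E]

/-- The radial retraction onto the closed unit ball. -/
noncomputable def radialClamp (x : E) : E := (max 1 ‖x‖)⁻¹ • x

theorem radialClamp_of_norm_le {x : E} (hx : ‖x‖ ≤ 1) : radialClamp x = x := by
  simp [radialClamp, max_eq_left hx]

theorem smul_radialClamp (x : E) : max 1 ‖x‖ • radialClamp x = x := by
  rw [radialClamp, smul_inv_smul₀ (by positivity)]

theorem norm_radialClamp_le (x : E) : ‖radialClamp x‖ ≤ 1 := by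
  rw [radialClamp, norm_smul, norm_inv, Real.norm_of_nonneg (by positivity), inv_mul_le_iff₀ (by positivity)]
  simp

theorem norm_radialClamp_of_le {x : E} (hx : 1 ≤ ‖x‖) : ‖radialClamp x‖ = 1 := by
  rw [radialClamp, norm_smul, norm_inv, Real.norm_of_nonneg (by positivity), max_eq_right hx,
    inv_mul_cancel₀ (by positivity)]

theorem lipschitzWith_radialClamp : LipschitzWith 2 (radialClamp : E → E) := by
  refine LipschitzWith.of_dist_le_mul fun x y => ?_
  rw [dist_eq_norm, dist_eq_norm]
  set α := max 1 ‖x‖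
  set β := max 1 ‖y‖
  have hα : 1 ≤ α := le_max_left _ _
  have hα0 : 0 < α := by positivity
  have hyβ : ‖radialClamp y‖ ≤ 1 := norm_radialClamp_le y
  have hab : |β - α| ≤ ‖x - y‖ := by
    rw [norm_sub_rev, show α = max ‖x‖ 1 from max_comm _ _, show β = max ‖y‖ 1 from max_comm _ _]
    exact (abs_max_sub_max_le_abs _ _ _).trans (abs_norm_sub_norm_le y x)
  -- Multiplying by `α ≥ 1` clears the denominators; `‖x - y‖` and `|β - α|` contribute one unit
  -- each to the constant 2.
  have h : α • (radialClamp x - radialClamp y) = (x - y) + (β - α) • radialClamp y := by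
    rw [smul_sub, smul_radialClamp, sub_smul, smul_radialClamp]
    abel
  calc ‖radialClamp x - radialClamp y‖ ≤ α * ‖radialClamp x - radialClamp y‖ :=
        le_mul_of_one_le_left (norm_nonneg _) hα
    _ = ‖(x - y) + (β - α) • radialClamp y‖ := by
        rw [← h, norm_smul, Real.norm_of_nonneg hα0.le]
    _ ≤ ‖x - y‖ + |β - α| * ‖radialClamp y‖ := (norm_add_le _ _).trans_eq (by rw [norm_smul]; rfl)
    _ ≤ ‖x - y‖ + ‖x - y‖ * 1 := by gcongr
    _ = (2 : ℝ≥0) * ‖x - y‖ := by push_cast; ring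

end Clamp

/-! ### Cone fields and invariance of the cone -/

section ConeField

variable {E G : Type*} [NormedAddCommGroup E] [InnerProductSpace ℝ E]
  [NormedAddCommGroup G] [InnerProductSpace ℝ G]

/-- A vector field on `E × G`, vanishing at the origin and Lipschitz on the product of the closed
unit balls, for which differences of points expand in the cone `‖Δb‖ ≤ M ‖Δa‖` and contract in the
cone `‖Δa‖ ≤ M ‖Δb‖`. -/
structure IsConeField (g : E × G → E × G) (M c : ℝ) (L : ℝ≥0) : Prop where
  one_lt : 1 < M
  pos : 0 < c
  zero : g 0 = 0
  lip : LipschitzOnWith L g (Metric.closedBall 0 1)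
  expand : ∀ z ∈ Metric.closedBall (0 : E × G) 1, ∀ w ∈ Metric.closedBall (0 : E × G) 1,
    ‖z.2 - w.2‖ ≤ M * ‖z.1 - w.1‖ →
      c * ‖z.1 - w.1‖ ^ 2 ≤ ⟪z.1 - w.1, (g z).1 - (g w).1⟫
  contract : ∀ z ∈ Metric.closedBall (0 : E × G) 1, ∀ w ∈ Metric.closedBall (0 : E × G) 1,
    ‖z.1 - w.1‖ ≤ M * ‖z.2 - w.2‖ →
      ⟪z.2 - w.2, (g z).2 - (g w).2⟫ ≤ -(c * ‖z.2 - w.2‖ ^ 2)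

theorem HasDerivWithinAt.prod_fst {z : ℝ → E × G} {z' : E × G} {s : Set ℝ} {t : ℝ}
    (h : HasDerivWithinAt z z' s t) : HasDerivWithinAt (fun r => (z r).1) z'.1 s t :=
  (ContinuousLinearMap.fst ℝ E G).hasFDerivAt.comp_hasDerivWithinAt t h

theorem HasDerivWithinAt.prod_snd {z : ℝ → E × G} {z' : E × G} {s : Set ℝ} {t : ℝ}
    (h : HasDerivWithinAt z z' s t) : HasDerivWithinAt (fun r => (z r).2) z'.2 s t :=
  (ContinuousLinearMap.snd ℝ E G).hasFDerivAt.comp_hasDerivWithinAt t h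

theorem mem_closedBall_prod_zero {E G : Type*} [NormedAddCommGroup E] [NormedAddCommGroup G]
    {z : E × G} :
    z ∈ Metric.closedBall (0 : E × G) 1 ↔ ‖z.1‖ ≤ 1 ∧ ‖z.2‖ ≤ 1 := by
  rw [mem_closedBall_zero_iff, Prod.norm_def, max_le_iff]

namespace IsConeField

variable {g : E × G → E × G} {M c : ℝ} {L : ℝ≥0}

theorem contract_zero (hg : IsConeField g M c L) {z : E × G}
    (hz : z ∈ Metric.closedBall (0 : E × G) 1) (h : ‖z.1‖ ≤ M * ‖z.2‖) :
    ⟪z.2, (g z).2⟫ ≤ -(c * ‖z.2‖ ^ 2) := by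
  simpa [hg.zero] using hg.contract z hz 0 (by simp) (by simpa using h)

theorem expand_zero (hg : IsConeField g M c L) {z : E × G}
    (hz : z ∈ Metric.closedBall (0 : E × G) 1) (h : ‖z.2‖ ≤ M * ‖z.1‖) :
    c * ‖z.1‖ ^ 2 ≤ ⟪z.1, (g z).1⟫ := by
  simpa [hg.zero] using hg.expand z hz 0 (by simp) (by simpa using h)

/-- Forward invariance of the cone `M ‖Δb‖ ≤ ‖Δa‖`. -/
theorem cone_forward (hg : IsConeField g M c L) {z w : ℝ → E × G} {a b : ℝ} (hab : a ≤ b)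
    (hz : IsIntegralCurveOn z (fun _ => g) (Icc a b))
    (hw : IsIntegralCurveOn w (fun _ => g) (Icc a b))
    (hzm : MapsTo z (Icc a b) (Metric.closedBall 0 1))
    (hwm : MapsTo w (Icc a b) (Metric.closedBall 0 1))
    (h : M * ‖(z a).2 - (w a).2‖ ≤ ‖(z a).1 - (w a).1‖) :
    M * ‖(z b).2 - (w b).2‖ ≤ ‖(z b).1 - (w b).1‖ := by
  have hM := hg.one_lt
  have hc := hg.pos
  have hright : ∀ {x : ℝ → E × G}, IsIntegralCurveOn x (fun _ => g) (Icc a b) →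
      ∀ t ∈ Ico a b, HasDerivWithinAt x (g (x t)) (Ici t) t := fun hx t ht =>
    (hx t (Ico_subset_Icc_self ht)).mono_of_mem_nhdsWithin (Icc_mem_nhdsGE_of_mem ht)
  -- Orbits that meet coincide afterwards. Otherwise `M²‖Δb‖² - ‖Δa‖²` decreases strictly wherever
  -- it vanishes, so it cannot become positive.
  by_cases hex : ∃ s ∈ Icc a b, z s = w s
  · obtain ⟨s, hs, heq⟩ := hex
    have : z b = w b := by
      refine ODE_solution_unique_of_mem_Icc_right (v := fun _ => g)
        (s := fun _ => Metric.closedBall 0 1) (K := L) (a := s) (b := b) (fun _ _ => hg.lip)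
        (hz.continuousOn.mono (Icc_subset_Icc_left hs.1))
        (fun t ht => hright hz t ⟨hs.1.trans ht.1, ht.2⟩)
        (fun t ht => hzm ⟨hs.1.trans ht.1, ht.2.le⟩)
        (hw.continuousOn.mono (Icc_subset_Icc_left hs.1))
        (fun t ht => hright hw t ⟨hs.1.trans ht.1, ht.2⟩)
        (fun t ht => hwm ⟨hs.1.trans ht.1, ht.2.le⟩) heq ⟨hs.2, le_rfl⟩
    simp [this]
  push Not at hex
  have hderiv : ∀ t ∈ Icc a b, HasDerivWithinAt
      (fun t => M ^ 2 * ‖(z t).2 - (w t).2‖ ^ 2 - ‖(z t).1 - (w t).1‖ ^ 2)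
      (M ^ 2 * (2 * ⟪(z t).2 - (w t).2, (g (z t)).2 - (g (w t)).2⟫)
        - 2 * ⟪(z t).1 - (w t).1, (g (z t)).1 - (g (w t)).1⟫) (Icc a b) t := fun t ht =>
    ((((hz t ht).prod_snd.sub (hw t ht).prod_snd).norm_sq).const_mul _).sub
      ((hz t ht).prod_fst.sub (hw t ht).prod_fst).norm_sq
  have key := image_le_of_deriv_right_lt_deriv_boundary' (a := a) (b := b)
    (f := fun t => M ^ 2 * ‖(z t).2 - (w t).2‖ ^ 2 - ‖(z t).1 - (w t).1‖ ^ 2)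
    (B := fun _ => 0) (B' := fun _ => 0)
    (fun t ht => (hderiv t ht).continuousWithinAt)
    (fun t ht => (hderiv t (Ico_subset_Icc_self ht)).mono_of_mem_nhdsWithin
      (Icc_mem_nhdsGE_of_mem ht))
    (by linarith [mul_pow M ‖(z a).2 - (w a).2‖ 2, pow_le_pow_left₀ (by positivity) h 2])
    continuousOn_const
    (fun _ _ => hasDerivWithinAt_const _ _ _) (fun t ht heq => by
      have ht' := Ico_subset_Icc_self ht
      have hne := hex t ht'
      set u := ‖(z t).1 - (w t).1‖ with hu
      set v := ‖(z t).2 - (w t).2‖ with hv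
      have hu0 : 0 ≤ u := norm_nonneg _
      have hv0 : 0 ≤ v := norm_nonneg _
      have huv : u = M * v := by
        refine (sq_eq_sq₀ hu0 (by positivity)).1 ?_
        linarith [mul_pow M v 2]
      have hvpos : 0 < v := by
        refine hv0.lt_of_ne fun h0 => hne (Prod.ext ?_ ?_)
        · rw [← h0, mul_zero] at huv
          exact sub_eq_zero.1 (norm_eq_zero.1 huv)
        · exact sub_eq_zero.1 (norm_eq_zero.1 h0.symm)
      -- With `u = M v` and `M > 1` the difference lies in both cones.
      have h1 := hg.expand _ (hzm ht') _ (hwm ht') (by rw [← hu, ← hv, huv]; nlinarith)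
      have h2 := hg.contract _ (hzm ht') _ (hwm ht') (by rw [← hu, ← hv, huv])
      rw [← hu] at h1
      rw [← hv] at h2
      have h3 : 0 < c * u ^ 2 := by rw [huv]; positivity
      have h4 : 0 ≤ M ^ 2 * (c * v ^ 2) := by positivity
      nlinarith [mul_le_mul_of_nonneg_left h2 (sq_nonneg M)]) ⟨hab, le_rfl⟩
  refine (pow_le_pow_iff_left₀ (by positivity) (by positivity) two_ne_zero).1 ?_
  linarith [mul_pow M ‖(z b).2 - (w b).2‖ 2]

/-- Two trajectories that stay in the unit box for all negative times lie in the cone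
`M ‖Δb‖ ≤ ‖Δa‖`. -/
theorem cone_of_backward (hg : IsConeField g M c L) {z w : ℝ → E × G} {T : ℝ}
    (hz : IsIntegralCurveOn z (fun _ => g) (Iic T))
    (hw : IsIntegralCurveOn w (fun _ => g) (Iic T))
    (hzm : MapsTo z (Iic T) (Metric.closedBall 0 1))
    (hwm : MapsTo w (Iic T) (Metric.closedBall 0 1)) :
    M * ‖(z T).2 - (w T).2‖ ≤ ‖(z T).1 - (w T).1‖ := by
  have hM := hg.one_lt
  have hc := hg.pos
  by_contra! hcon
  have hout : ∀ t ≤ T, ‖(z t).1 - (w t).1‖ ≤ M * ‖(z t).2 - (w t).2‖ := by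
    intro t ht
    by_contra! h
    have hsub : Icc t T ⊆ Iic T := fun _ h => h.2
    exact (hg.cone_forward ht (hz.mono hsub) (hw.mono hsub) (hzm.mono_left hsub)
      (hwm.mono_left hsub) h.le).not_gt hcon
  -- Outside the cone `v t * exp (2ct)` is antitone, yet it is at most `4 exp (2ct)`, which tends to
  -- `0` as `t → -∞`; so it cannot be positive at `T`.
  set v : ℝ → ℝ := fun t => ‖(z t).2 - (w t).2‖ ^ 2 with hv
  have hderiv : ∀ t ∈ Iic T, HasDerivWithinAt (fun t => v t * Real.exp (2 * c * t))
      (2 * ⟪(z t).2 - (w t).2, (g (z t)).2 - (g (w t)).2⟫ * Real.exp (2 * c * t)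
        + v t * (Real.exp (2 * c * t) * (2 * c))) (Iic T) t := fun t ht =>
    ((hz t ht).prod_snd.sub (hw t ht).prod_snd).norm_sq.mul
      (((hasDerivAt_id t).const_mul (2 * c)).exp.congr_deriv (by simp)).hasDerivWithinAt
  have hanti : AntitoneOn (fun t => v t * Real.exp (2 * c * t)) (Iic T) := by
    refine antitoneOn_of_hasDerivWithinAt_nonpos (convex_Iic T)
      (fun t ht => (hderiv t ht).continuousWithinAt)
      (fun t ht => (hderiv t (interior_subset ht)).mono interior_subset) fun t ht => ?_
    have ht' : t ≤ T := interior_subset (s := Iic T) ht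
    have h := hg.contract _ (hzm ht') _ (hwm ht') (hout t ht')
    have he := Real.exp_pos (2 * c * t)
    have : 2 * ⟪(z t).2 - (w t).2, (g (z t)).2 - (g (w t)).2⟫ * Real.exp (2 * c * t)
        + v t * (Real.exp (2 * c * t) * (2 * c)) =
        (2 * Real.exp (2 * c * t)) *
          (⟪(z t).2 - (w t).2, (g (z t)).2 - (g (w t)).2⟫ + c * v t) := by ring
    rw [this]
    exact mul_nonpos_of_nonneg_of_nonpos (by positivity) (by simp only [hv]; linarith)
  have hvT : 0 < v T * Real.exp (2 * c * T) := by
    have : 0 < ‖(z T).2 - (w T).2‖ := by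
      by_contra! h
      have := norm_nonneg ((z T).1 - (w T).1)
      nlinarith
    positivity
  have hbound : ∀ t ≤ T, v T * Real.exp (2 * c * T) ≤ 4 * Real.exp (2 * c * t) := by
    intro t ht
    refine (hanti (mem_Iic.2 ht) (mem_Iic.2 le_rfl) ht).trans ?_
    have h1 := (mem_closedBall_prod_zero.1 (hzm ht)).2
    have h2 := (mem_closedBall_prod_zero.1 (hwm ht)).2
    have h3 : ‖(z t).2 - (w t).2‖ ≤ 2 := (norm_sub_le _ _).trans (by linarith)
    have h4 : v t ≤ 4 := by
      have := norm_nonneg ((z t).2 - (w t).2)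
      simp only [hv]; nlinarith
    exact mul_le_mul_of_nonneg_right h4 (Real.exp_pos _).le
  have hlim : Tendsto (fun t : ℝ => 4 * Real.exp (2 * c * t)) atBot (𝓝 0) := by
    have := (Real.tendsto_exp_atBot.comp (tendsto_id.const_mul_atBot (by positivity : 0 < 2 * c)))
    simpa using this.const_mul 4
  exact (ge_of_tendsto hlim (eventually_le_atBot T |>.mono hbound)).not_gt hvT

end IsConeField
end ConeField

/-! ### Global extension, graph transform and backward orbits -/

section Extension

variable {E G : Type*} [NormedAddCommGroup E] [InnerProductSpace ℝ E]
  [NormedAddCommGroup G] [InnerProductSpace ℝ G]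

/-- The extension of a vector field on the product of the unit balls which is constant along the
fibres of the product of the radial retractions. -/
noncomputable def clampField (g : E × G → E × G) (z : E × G) : E × G :=
  g (radialClamp z.1, radialClamp z.2)

theorem clampField_of_mem {g : E × G → E × G} {z : E × G}
    (hz : z ∈ Metric.closedBall (0 : E × G) 1) : clampField g z = g z := by
  rw [mem_closedBall_prod_zero] at hz
  rw [clampField, radialClamp_of_norm_le hz.1, radialClamp_of_norm_le hz.2]

theorem clamp_mem_closedBall (z : E × G) :
    (radialClamp z.1, radialClamp z.2) ∈ Metric.closedBall (0 : E × G) 1 :=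
  mem_closedBall_prod_zero.2 ⟨norm_radialClamp_le _, norm_radialClamp_le _⟩

namespace IsConeField

variable {g : E × G → E × G} {M c : ℝ} {L : ℝ≥0}

theorem lipschitzWith_clampField (hg : IsConeField g M c L) :
    LipschitzWith (L * 2) (clampField g) := by
  have h : LipschitzWith 2 fun z : E × G => (radialClamp z.1, radialClamp z.2) := by
    have := (lipschitzWith_radialClamp.comp (LipschitzWith.prod_fst (α := E) (β := G))).prodMk
      (lipschitzWith_radialClamp.comp (LipschitzWith.prod_snd (α := E) (β := G)))
    simpa using! this
  have := hg.lip.comp (h.lipschitzOnWith (s := univ)) fun z _ => clamp_mem_closedBall z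
  exact lipschitzOnWith_univ.1 this

theorem norm_clampField_le (hg : IsConeField g M c L) (z : E × G) : ‖clampField g z‖ ≤ L := by
  have h := hg.lip.dist_le_mul _ (clamp_mem_closedBall z) 0 (by simp)
  rw [hg.zero, dist_zero_right, dist_zero_right] at h
  have h1 := mem_closedBall_zero_iff.1 (clamp_mem_closedBall z)
  exact h.trans (mul_le_of_le_one_right L.coe_nonneg h1)

/-- The clamped point has `‖a‖ = 1` and `‖b‖ ≤ 1 < M`, so expansion from the origin applies there,
and `z.1` is a positive multiple of the clamped `a`. -/
theorem inner_clampField_fst_pos (hg : IsConeField g M c L) {z : E × G} (hz : 1 ≤ ‖z.1‖) :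
    0 < ⟪z.1, (clampField g z).1⟫ := by
  have h := hg.expand_zero (clamp_mem_closedBall z) (by
    simp only [norm_radialClamp_of_le hz]
    linarith [norm_radialClamp_le z.2, hg.one_lt])
  simp only [norm_radialClamp_of_le hz, one_pow, mul_one] at h
  rw [← smul_radialClamp z.1, real_inner_smul_left]
  exact mul_pos (by positivity) (hg.pos.trans_le h)

theorem inner_clampField_snd_neg (hg : IsConeField g M c L) {z : E × G} (hz : 1 ≤ ‖z.2‖) :
    ⟪z.2, (clampField g z).2⟫ < 0 := by
  have h := hg.contract_zero (clamp_mem_closedBall z) (by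
    simp only [norm_radialClamp_of_le hz]
    linarith [norm_radialClamp_le z.1, hg.one_lt])
  simp only [norm_radialClamp_of_le hz, one_pow, mul_one] at h
  rw [← smul_radialClamp z.2, real_inner_smul_left]
  exact mul_neg_of_pos_of_neg (by positivity) (h.trans_lt (neg_lt_zero.2 hg.pos))

theorem norm_snd_le_one_of_le (hg : IsConeField g M c L) {γ : ℝ → E × G}
    (hγ : IsIntegralCurve γ fun _ => clampField g) {s t : ℝ} (hst : s ≤ t)
    (h : ‖(γ s).2‖ ≤ 1) : ‖(γ t).2‖ ≤ 1 := by
  have hd : ∀ t, HasDerivAt (fun t => ‖(γ t).2‖ ^ 2) (2 * ⟪(γ t).2, (clampField g (γ t)).2⟫) t :=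
    fun t => by
      rw [← hasDerivWithinAt_univ]
      exact (hγ t).hasDerivWithinAt.prod_snd.norm_sq
  have key := image_le_of_deriv_right_lt_deriv_boundary' (a := s) (b := t) (B := fun _ => 1)
    (B' := fun _ => 0) (fun t _ => (hd t).continuousAt.continuousWithinAt)
    (fun t _ => (hd t).hasDerivWithinAt) (pow_le_one₀ (norm_nonneg _) h) continuousOn_const
    (fun _ _ => hasDerivWithinAt_const _ _ _) (fun t _ heq => by
      have h1 : ‖(γ t).2‖ = 1 := (pow_eq_one_iff_of_nonneg (norm_nonneg _) two_ne_zero).1 heq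
      linarith [hg.inner_clampField_snd_neg h1.ge]) ⟨hst, le_rfl⟩
  exact (pow_le_one_iff_of_nonneg (norm_nonneg _) two_ne_zero).1 key

/-- Outside the open unit ball the field points outward in `a`. Hence an orbit whose `a`-coordinate
ends in the closed ball never left it before. -/
theorem norm_fst_le_of_one_le (hg : IsConeField g M c L) {γ : ℝ → E × G}
    (hγ : IsIntegralCurve γ fun _ => clampField g) {s t : ℝ} (hst : s ≤ t)
    (h : 1 ≤ ‖(γ s).1‖) : ‖(γ s).1‖ ≤ ‖(γ t).1‖ := by
  have hd : ∀ t, HasDerivAt (fun t => -‖(γ t).1‖ ^ 2)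
      (-(2 * ⟪(γ t).1, (clampField g (γ t)).1⟫)) t :=
    fun t => by
      rw [← hasDerivWithinAt_univ]
      exact (hγ t).hasDerivWithinAt.prod_fst.norm_sq.neg
  have key := image_le_of_deriv_right_lt_deriv_boundary' (a := s) (b := t)
    (B := fun _ => -‖(γ s).1‖ ^ 2)
    (B' := fun _ => 0) (fun t _ => (hd t).continuousAt.continuousWithinAt)
    (fun t _ => (hd t).hasDerivWithinAt) le_rfl continuousOn_const
    (fun _ _ => hasDerivWithinAt_const _ _ _) (fun t _ heq => by
      have h1 : ‖(γ t).1‖ = ‖(γ s).1‖ :=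
        (sq_eq_sq₀ (norm_nonneg _) (norm_nonneg _)).1 (neg_inj.1 heq)
      linarith [hg.inner_clampField_fst_pos (h.trans h1.ge)]) ⟨hst, le_rfl⟩
  exact (pow_le_pow_iff_left₀ (norm_nonneg _) (norm_nonneg _) two_ne_zero).1 (neg_le_neg_iff.1 key)

theorem exists_flow [CompleteSpace E] [CompleteSpace G] (hg : IsConeField g M c L) (z : E × G) :
    ∃ γ : ℝ → E × G, γ 0 = z ∧ IsIntegralCurve γ fun _ => clampField g :=
  exists_isIntegralCurve_of_lipschitz_of_bounded hg.lipschitzWith_clampField hg.norm_clampField_le z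

/-- The displacement of trajectories over a time span `h` depends on the initial point in a
Lipschitz way, with a constant proportional to `h`. -/
theorem dist_displacement_le {X : Type*} [NormedAddCommGroup X] [NormedSpace ℝ X] {v : X → X}
    {K : ℝ≥0} (hv : LipschitzWith K v) {γ δ : ℝ → X} (hγ : IsIntegralCurve γ fun _ => v)
    (hδ : IsIntegralCurve δ fun _ => v) {h : ℝ} (hh : 0 ≤ h) (hK : K * h ≤ 1 / 8) :
    ‖(γ h - γ 0) - (δ h - δ 0)‖ ≤ 1 / 7 * ‖γ 0 - δ 0‖ := by
  -- From `1 - 1/8 ≤ exp (-1/8)`.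
  have hexp : Real.exp (K * h) ≤ 8 / 7 := by
    refine (Real.exp_le_exp.2 hK).trans ?_
    have h1 := Real.add_one_le_exp (-(1 / 8 : ℝ))
    rw [Real.exp_neg] at h1
    have h2 := Real.exp_pos (1 / 8)
    have h3 := mul_le_mul_of_nonneg_right h1 h2.le
    rw [inv_mul_cancel₀ h2.ne'] at h3
    linarith
  have hbound : ∀ t ∈ Ico 0 h, ‖v (γ t) - v (δ t)‖ ≤ K * (‖γ 0 - δ 0‖ * (8 / 7)) := by
    intro t ht
    rw [← dist_eq_norm, ← dist_eq_norm]
    refine (hv.dist_le_mul _ _).trans (mul_le_mul_of_nonneg_left ?_ K.coe_nonneg)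
    refine (dist_le_exp_of_isIntegralCurve_of_le hv hγ hδ ht.1).trans ?_
    refine mul_le_mul_of_nonneg_left (le_trans ?_ hexp) dist_nonneg
    refine Real.exp_le_exp.2 (mul_le_mul_of_nonneg_left ?_ K.coe_nonneg)
    linarith [ht.2]
  have := norm_image_sub_le_of_norm_deriv_le_segment' (f := fun t => γ t - δ t) (a := 0) (b := h)
    (fun t _ => ((hγ t).sub (hδ t)).hasDerivWithinAt) hbound h ⟨hh, le_rfl⟩
  calc ‖(γ h - γ 0) - (δ h - δ 0)‖ = ‖(γ h - δ h) - (γ 0 - δ 0)‖ := by congr 1; abel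
    _ ≤ K * (‖γ 0 - δ 0‖ * (8 / 7)) * (h - 0) := this
    _ = (K * h) * (8 / 7 * ‖γ 0 - δ 0‖) := by ring
    _ ≤ 1 / 8 * (8 / 7 * ‖γ 0 - δ 0‖) := by gcongr
    _ = 1 / 7 * ‖γ 0 - δ 0‖ := by ring

/-- The image of a Lipschitz graph under the time `h` flow covers the unit ball, by trajectories
that stay in the unit box. -/
theorem exists_graph_transform_preimage [CompleteSpace E] [CompleteSpace G]
    (hg : IsConeField g M c L) {h : ℝ} (hh : 0 ≤ h) (hL : ((L * 2 : ℝ≥0) : ℝ) * h ≤ 1 / 8)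
    {σ : E → G} (hσ : ∀ a, ‖a‖ ≤ 1 → ‖σ a‖ ≤ 1)
    (hσL : ∀ a a', ‖a‖ ≤ 1 → ‖a'‖ ≤ 1 → M * ‖σ a - σ a'‖ ≤ ‖a - a'‖) {a₀ : E} (ha₀ : ‖a₀‖ ≤ 1) :
    ∃ a, ‖a‖ ≤ 1 ∧ ∃ γ : ℝ → E × G, γ 0 = (a, σ a) ∧ (IsIntegralCurve γ fun _ => clampField g) ∧
      (γ h).1 = a₀ ∧ ∀ t ∈ Icc 0 h, γ t ∈ Metric.closedBall (0 : E × G) 1 := by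
  choose φ hφ0 hφ using hg.exists_flow
  let D : E → E × G := fun a => φ (a, σ a) h - (a, σ a)
  have hD : ∀ a a', ‖a‖ ≤ 1 → ‖a'‖ ≤ 1 → ‖(D a).1 - (D a').1‖ ≤ 1 / 7 * ‖a - a'‖ := by
    intro a a' ha ha'
    have h1 := dist_displacement_le hg.lipschitzWith_clampField (hφ (a, σ a)) (hφ (a', σ a')) hh hL
    rw [hφ0, hφ0] at h1
    refine (norm_fst_le (D a - D a')).trans (h1.trans ?_)
    have h2 : ‖σ a - σ a'‖ ≤ ‖a - a'‖ :=
      (le_mul_of_one_le_left (norm_nonneg _) hg.one_lt.le).trans (hσL a a' ha ha')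
    have h3 : ‖(a, σ a) - (a', σ a')‖ ≤ ‖a - a'‖ := by
      rw [Prod.mk_sub_mk, Prod.norm_def]
      exact max_le le_rfl h2
    linarith
  -- The equation `(γ h).1 = a₀` reads `a = a₀ - (D a).1`. The clamps make `T` defined everywhere;
  -- each costs a factor 2, so the contraction constant is `2 · 1/7 · 2 = 4/7`.
  let T : E → E := fun a => radialClamp (a₀ - (D (radialClamp a)).1)
  have hT : ContractingWith (4 / 7) T := by
    refine ⟨by rw [← NNReal.coe_lt_coe]; norm_num, LipschitzWith.of_dist_le_mul fun a a' => ?_⟩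
    refine (lipschitzWith_radialClamp.dist_le_mul _ _).trans ?_
    have h1 := hD _ _ (norm_radialClamp_le a) (norm_radialClamp_le a')
    have h2 := lipschitzWith_radialClamp.dist_le_mul a a'
    rw [dist_sub_left, dist_eq_norm]
    rw [dist_eq_norm] at h2
    push_cast at h2 ⊢
    linarith
  set a := hT.fixedPoint T with ha
  have hfix : radialClamp (a₀ - (D (radialClamp a)).1) = a := hT.fixedPoint_isFixedPt
  have ha1 : ‖a‖ ≤ 1 := by rw [← hfix]; exact norm_radialClamp_le _
  rw [radialClamp_of_norm_le ha1] at hfix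
  have hγ := hφ (a, σ a)
  have hγ0 := hφ0 (a, σ a)
  set γ := φ (a, σ a) with hγdef
  have hDa : (D a).1 = (γ h).1 - a := rfl
  have hend : (γ h).1 = a₀ := by
    rcases le_or_gt ‖a₀ - (D a).1‖ 1 with hle | hgt
    · rw [radialClamp_of_norm_le hle, hDa] at hfix
      have : a₀ - (γ h).1 = 0 := by
        have h1 : a₀ - ((γ h).1 - a) - a = 0 := sub_eq_zero.2 hfix
        rw [← h1]; abel
      exact (sub_eq_zero.1 this).symm
    -- If the outer clamp were active, `a` would be on the unit sphere and `a₀ = (s - 1) a + (γ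
    -- h).1` with `s > 1`. The orbit moves outward and by at most 1, so `‖(γ h).1‖ ≥ 1` and `⟪a, (γ
    -- h).1⟫ ≥ 0`, forcing `‖a₀‖ > 1`.
    · exfalso
      have hna : ‖a‖ = 1 := by rw [← hfix]; exact norm_radialClamp_of_le hgt.le
      have hs := smul_radialClamp (a₀ - (D a).1)
      rw [hfix, max_eq_right hgt.le] at hs
      set s := ‖a₀ - (D a).1‖
      have ha0 : a₀ = (s - 1) • a + (γ h).1 := by
        rw [sub_smul, hs, hDa, one_smul]; abel
      have hout : 1 ≤ ‖(γ h).1‖ := by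
        have := hg.norm_fst_le_of_one_le hγ hh (by rw [hγ0, hna])
        rwa [hγ0, hna] at this
      have hdisp : ‖(D a).1‖ ≤ 1 := by
        have h1 := norm_image_sub_le_of_norm_deriv_le_segment' (f := γ) (a := 0) (b := h)
          (fun t _ => (hγ t).hasDerivWithinAt) (fun t _ => hg.norm_clampField_le (γ t)) h
          ⟨hh, le_rfl⟩
        rw [hγ0] at h1
        push_cast at hL
        refine (norm_fst_le (D a)).trans (h1.trans ?_)
        nlinarith [L.coe_nonneg]
      have hin : 0 ≤ ⟪a, (γ h).1⟫ := by
        have h1 : (γ h).1 = a + (D a).1 := by rw [hDa]; abel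
        rw [h1, inner_add_right, real_inner_self_eq_norm_sq, hna]
        have := neg_le_of_abs_le (abs_real_inner_le_norm a (D a).1)
        rw [hna] at this
        linarith
      have hn := norm_add_sq_real ((s - 1) • a) (γ h).1
      rw [← ha0, real_inner_smul_left, norm_smul, hna, Real.norm_of_nonneg (by linarith)] at hn
      have h1 : ‖a₀‖ ^ 2 ≤ 1 := pow_le_one₀ (norm_nonneg _) ha₀
      have h2 : 1 ≤ ‖(γ h).1‖ ^ 2 := one_le_pow₀ hout
      have h3 : 0 < s - 1 := by linarith
      nlinarith [mul_nonneg h3.le hin, mul_pos h3 h3]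
  refine ⟨a, ha1, γ, hγ0, hγ, hend, fun t ht => mem_closedBall_prod_zero.2 ⟨?_, ?_⟩⟩
  · by_contra! hcon
    have := hg.norm_fst_le_of_one_le hγ ht.2 hcon.le
    rw [hend] at this
    linarith
  · exact hg.norm_snd_le_one_of_le hγ ht.1 (by rw [hγ0]; exact hσ a ha1)

theorem isIntegralCurveOn_of_mapsTo {γ : ℝ → E × G} {s : Set ℝ}
    (hγ : IsIntegralCurve γ fun _ => clampField g)
    (hm : ∀ t ∈ s, γ t ∈ Metric.closedBall (0 : E × G) 1) :
    IsIntegralCurveOn γ (fun _ => g) s := fun t ht => by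
  have := (hγ t).hasDerivWithinAt (s := s)
  beta_reduce at this ⊢
  rwa [clampField_of_mem (hm t ht)] at this

/-- Iterates the graph transform from the zero graph: cone invariance keeps the Lipschitz constant,
and each step prolongs the backward orbits in the box by `h`. -/
theorem exists_graph_of_backward_steps [CompleteSpace E] [CompleteSpace G]
    (hg : IsConeField g M c L) {h : ℝ} (hh : 0 ≤ h) (hL : ((L * 2 : ℝ≥0) : ℝ) * h ≤ 1 / 8) (n : ℕ) :
    ∃ σ : E → G, (∀ a, ‖a‖ ≤ 1 → ‖σ a‖ ≤ 1) ∧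
      (∀ a a', ‖a‖ ≤ 1 → ‖a'‖ ≤ 1 → M * ‖σ a - σ a'‖ ≤ ‖a - a'‖) ∧
      ∀ a, ‖a‖ ≤ 1 → ∃ γ : ℝ → E × G, γ 0 = (a, σ a) ∧
        (IsIntegralCurve γ fun _ => clampField g) ∧
        ∀ t ∈ Icc (-(n * h)) 0, γ t ∈ Metric.closedBall (0 : E × G) 1 := by
  induction n with
  | zero =>
    refine ⟨fun _ => 0, by simp, by simp, fun a ha => ?_⟩
    obtain ⟨γ, h0, hγ⟩ := hg.exists_flow (a, 0)
    refine ⟨γ, h0, hγ, fun t ht => ?_⟩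
    obtain rfl : t = 0 := by simpa using! ht
    rw [h0, mem_closedBall_prod_zero]
    simpa using ha
  | succ n ih =>
    obtain ⟨σ, hσ, hσL, hback⟩ := ih
    have key : ∀ a₀ : E, ∃ γ : ℝ → E × G, ‖a₀‖ ≤ 1 → ∃ a, ‖a‖ ≤ 1 ∧ γ 0 = (a, σ a) ∧
        (IsIntegralCurve γ fun _ => clampField g) ∧ (γ h).1 = a₀ ∧
        ∀ t ∈ Icc 0 h, γ t ∈ Metric.closedBall (0 : E × G) 1 := by
      intro a₀
      by_cases ha₀ : ‖a₀‖ ≤ 1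
      · obtain ⟨a, ha, γ, h1⟩ := hg.exists_graph_transform_preimage hh hL hσ hσL ha₀
        exact ⟨γ, fun _ => ⟨a, ha, h1⟩⟩
      · exact ⟨0, fun h => absurd h ha₀⟩
    choose Γ hΓ using key
    refine ⟨fun a₀ => (Γ a₀ h).2, fun a₀ ha₀ => ?_, fun a₀ a₁ ha₀ ha₁ => ?_, fun a₀ ha₀ => ?_⟩
    · obtain ⟨a, -, -, -, -, hm⟩ := hΓ a₀ ha₀
      exact (mem_closedBall_prod_zero.1 (hm h ⟨hh, le_rfl⟩)).2
    · obtain ⟨a, ha, h0, hγ, he, hm⟩ := hΓ a₀ ha₀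
      obtain ⟨a', ha', h0', hγ', he', hm'⟩ := hΓ a₁ ha₁
      have := hg.cone_forward hh (isIntegralCurveOn_of_mapsTo hγ hm)
        (isIntegralCurveOn_of_mapsTo hγ' hm') hm hm'
        (by rw [h0, h0']; exact hσL a a' ha ha')
      rwa [he, he'] at this
    · obtain ⟨a, ha, h0, hγ, he, hm⟩ := hΓ a₀ ha₀
      obtain ⟨δ, hδ0, hδ, hδm⟩ := hback a ha
      refine ⟨fun t => Γ a₀ (t + h), Prod.ext (by simpa using he) (by simp),
        hγ.comp_add_const h, fun t ht => ?_⟩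
      rcases le_total 0 (t + h) with hpos | hneg
      · exact hm _ ⟨hpos, by linarith [ht.2]⟩
      · beta_reduce
        -- Before the last step the shifted curve is, by uniqueness, the orbit supplied by the
        -- induction hypothesis.
        rw [hγ.eq_of_eq_at hg.lipschitzWith_clampField hδ (h0.trans hδ0.symm)]
        refine hδm _ ⟨?_, hneg⟩
        have := ht.1
        push_cast at this
        linarith

/-- Through each fibre of the unit box there is a trajectory that stays in the box for all negative
times. -/
theorem exists_backward [CompleteSpace E] [ProperSpace G] (hg : IsConeField g M c L) {a₀ : E}
    (ha₀ : ‖a₀‖ ≤ 1) :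
    ∃ γ : ℝ → E × G, (γ 0).1 = a₀ ∧ IsIntegralCurveOn γ (fun _ => g) (Iic 0) ∧
      MapsTo γ (Iic 0) (Metric.closedBall 0 1) := by
  -- The `+ 1` covers `L = 0`.
  set h : ℝ := 1 / (8 * (L * 2 + 1)) with hh
  have hh0 : 0 < h := by positivity
  have hL : ((L * 2 : ℝ≥0) : ℝ) * h ≤ 1 / 8 := by
    rw [hh]
    push_cast
    rw [mul_one_div, div_le_div_iff₀ (by positivity) (by norm_num)]
    linarith
  choose σ hσ _ hback using hg.exists_graph_of_backward_steps hh0.le hL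
  choose Γ hΓ0 hΓ hΓm using fun n => hback n a₀ ha₀
  -- All approximating orbits end over `a₀`, so only their `b`-coordinates need compactness;
  -- continuous dependence then carries the closed box condition to the limit orbit at every `t ≤
  -- 0`.
  obtain ⟨b, -, ψ, hψ, hlim⟩ := (isCompact_closedBall (0 : G) 1).tendsto_subseq
    (x := fun n => σ n a₀) fun n => mem_closedBall_zero_iff.2 (hσ n a₀ ha₀)
  obtain ⟨γ, hγ0, hγ⟩ := hg.exists_flow (a₀, b)
  have hm : MapsTo γ (Iic 0) (Metric.closedBall 0 1) := by
    intro t ht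
    have hz : Tendsto (fun n => dist (Γ (ψ n) 0) (γ 0)) atTop (𝓝 0) := by
      rw [← tendsto_iff_dist_tendsto_zero, hγ0]
      simp only [hΓ0]
      exact tendsto_const_nhds.prodMk_nhds hlim
    have hconv : Tendsto (fun n => Γ (ψ n) t) atTop (𝓝 (γ t)) := by
      rw [tendsto_iff_dist_tendsto_zero]
      refine squeeze_zero (fun _ => dist_nonneg) (fun n => dist_le_exp_of_isIntegralCurve
        hg.lipschitzWith_clampField (hΓ (ψ n)) hγ 0 t) ?_
      simpa using! hz.mul_const (Real.exp (((L * 2 : ℝ≥0) : ℝ) * |t - 0|))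
    refine Metric.isClosed_closedBall.mem_of_tendsto hconv ?_
    have : ∀ᶠ n : ℕ in atTop, -t / h ≤ n := tendsto_natCast_atTop_atTop.eventually_ge_atTop _
    filter_upwards [this] with n hn
    refine hΓm _ t ⟨?_, ht⟩
    have h1 : (n : ℝ) ≤ ψ n := by exact_mod_cast hψ.id_le n
    rw [div_le_iff₀ hh0] at hn
    nlinarith
  exact ⟨γ, by rw [hγ0], isIntegralCurveOn_of_mapsTo hγ hm, hm⟩

theorem isIntegralCurveOn_zero (hg : IsConeField g M c L) (s : Set ℝ) :
    IsIntegralCurveOn (fun _ => (0 : E × G)) (fun _ => g) s := fun t _ => by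
  simpa only [hg.zero] using hasDerivWithinAt_const t s (0 : E × G)

theorem mul_norm_snd_le_of_backward (hg : IsConeField g M c L) {z : ℝ → E × G} {T : ℝ}
    (hz : IsIntegralCurveOn z (fun _ => g) (Iic T))
    (hzm : MapsTo z (Iic T) (Metric.closedBall 0 1)) : M * ‖(z T).2‖ ≤ ‖(z T).1‖ := by
  simpa using hg.cone_of_backward hz (hg.isIntegralCurveOn_zero _) hzm (fun t _ => by simp)

/-- Trajectories that stay in the unit box for all negative times converge to the origin. -/
theorem tendsto_zero_of_backward (hg : IsConeField g M c L) {z : ℝ → E × G} {T : ℝ}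
    (hz : IsIntegralCurveOn z (fun _ => g) (Iic T))
    (hzm : MapsTo z (Iic T) (Metric.closedBall 0 1)) : Tendsto z atBot (𝓝 0) := by
  have hM := hg.one_lt
  have hc := hg.pos
  have hcone : ∀ t ≤ T, M * ‖(z t).2‖ ≤ ‖(z t).1‖ := fun t ht =>
    hg.mul_norm_snd_le_of_backward (hz.mono (Iic_subset_Iic.2 ht))
      (hzm.mono_left (Iic_subset_Iic.2 ht))
  have hle : ∀ t ≤ T, ‖(z t).2‖ ≤ ‖(z t).1‖ := fun t ht =>
    (le_mul_of_one_le_left (norm_nonneg _) hM.le).trans (hcone t ht)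
  -- Expansion makes `‖a‖² exp (-2ct)` monotone, so `‖a‖` decays exponentially backward, and `‖b‖ ≤
  -- ‖a‖` by the cone.
  have hderiv : ∀ t ∈ Iic T, HasDerivWithinAt (fun t => ‖(z t).1‖ ^ 2 * Real.exp (-(2 * c) * t))
      (2 * ⟪(z t).1, (g (z t)).1⟫ * Real.exp (-(2 * c) * t)
        + ‖(z t).1‖ ^ 2 * (Real.exp (-(2 * c) * t) * (-(2 * c)))) (Iic T) t := fun t ht =>
    (hz t ht).prod_fst.norm_sq.mul
      (((hasDerivAt_id t).const_mul (-(2 * c))).exp.congr_deriv (by simp)).hasDerivWithinAt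
  have hmono : MonotoneOn (fun t => ‖(z t).1‖ ^ 2 * Real.exp (-(2 * c) * t)) (Iic T) := by
    refine monotoneOn_of_hasDerivWithinAt_nonneg (convex_Iic T)
      (fun t ht => (hderiv t ht).continuousWithinAt)
      (fun t ht => (hderiv t (interior_subset ht)).mono interior_subset) fun t ht => ?_
    have ht' : t ≤ T := interior_subset (s := Iic T) ht
    have h := hg.expand_zero (hzm ht')
      ((hle t ht').trans (le_mul_of_one_le_left (norm_nonneg _) hM.le))
    have : 2 * ⟪(z t).1, (g (z t)).1⟫ * Real.exp (-(2 * c) * t)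
        + ‖(z t).1‖ ^ 2 * (Real.exp (-(2 * c) * t) * (-(2 * c))) =
        (2 * Real.exp (-(2 * c) * t)) * (⟪(z t).1, (g (z t)).1⟫ - c * ‖(z t).1‖ ^ 2) := by ring
    rw [this]
    exact mul_nonneg (by positivity) (by linarith)
  have hbound : ∀ t ≤ T, ‖z t‖ ^ 2 ≤
      ‖(z T).1‖ ^ 2 * Real.exp (-(2 * c) * T) * Real.exp (2 * c * t) := by
    intro t ht
    have h1 := hmono (mem_Iic.2 ht) (mem_Iic.2 le_rfl) ht
    have h2 : ‖z t‖ = ‖(z t).1‖ := by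
      rw [Prod.norm_def]
      exact max_eq_left (hle t ht)
    rw [h2]
    calc ‖(z t).1‖ ^ 2 = ‖(z t).1‖ ^ 2 * Real.exp (-(2 * c) * t) * Real.exp (2 * c * t) := by
          rw [mul_assoc, ← Real.exp_add]; simp
      _ ≤ _ := mul_le_mul_of_nonneg_right h1 (Real.exp_pos _).le
  have hlim : Tendsto (fun t : ℝ => ‖(z T).1‖ ^ 2 * Real.exp (-(2 * c) * T) *
      Real.exp (2 * c * t)) atBot (𝓝 0) := by
    have := (Real.tendsto_exp_atBot.comp (tendsto_id.const_mul_atBot (by positivity : 0 < 2 * c)))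
    simpa using this.const_mul (‖(z T).1‖ ^ 2 * Real.exp (-(2 * c) * T))
  have hsq : Tendsto (fun t => ‖z t‖ ^ 2) atBot (𝓝 0) :=
    squeeze_zero' (Eventually.of_forall fun _ => by positivity)
      ((eventually_le_atBot T).mono hbound) hlim
  rw [tendsto_zero_iff_norm_tendsto_zero]
  simpa [Real.sqrt_sq] using hsq.sqrt

end IsConeField
end Extension

/-! ### Logarithmic norms and quadratic forms -/

section LogarithmicNormBounds

variable {E : Type*} [NormedAddCommGroup E] [InnerProductSpace ℝ E]

/-- For every `h > 0`, `1 + h⟪Ae, e⟫ = ⟪(1 + hA)e, e⟫ ≤ ‖1 + hA‖`, so each quotient is already large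
enough. -/
theorem inner_le_logNorm (A : E →L[ℝ] E) {e : E} (he : ‖e‖ = 1) :
    ((⟪A e, e⟫ : ℝ) : EReal) ≤ logNorm A := by
  refine le_limsup_of_frequently_le (Eventually.frequently ?_)
  filter_upwards [self_mem_nhdsWithin] with h (hh : 0 < h)
  rw [EReal.coe_le_coe_iff, le_div_iff₀ hh, le_sub_iff_add_le]
  have h1 : ⟪(1 + h • A) e, e⟫ = ⟪A e, e⟫ * h + 1 := by
    simp only [add_apply, one_apply_eq_self,
      smul_apply, inner_add_left, real_inner_smul_left,
      real_inner_self_eq_norm_sq, he]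
    ring
  rw [← h1]
  have h2 := (1 + h • A).le_opNorm e
  rw [he, mul_one] at h2
  refine (real_inner_le_norm _ _).trans ?_
  rwa [he, mul_one]

/-- This is `√(1 + 2x) ≤ 1 + x` for the exact expansion of `‖(1 + hA)e‖²`. -/
theorem norm_one_add_smul_apply_le (A : E →L[ℝ] E) {e : E} (he : ‖e‖ = 1) {h : ℝ} (hh : 0 ≤ h)
    (hpos : 0 ≤ 1 + h * (⟪A e, e⟫ + h * ‖A e‖ ^ 2 / 2)) :
    ‖(1 + h • A) e‖ ≤ 1 + h * (⟪A e, e⟫ + h * ‖A e‖ ^ 2 / 2) := by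
  refine (pow_le_pow_iff_left₀ (norm_nonneg _) hpos two_ne_zero).1 ?_
  have h1 : ‖(1 + h • A) e‖ ^ 2 = 1 + 2 * h * ⟪A e, e⟫ + h ^ 2 * ‖A e‖ ^ 2 := by
    simp only [add_apply, one_apply_eq_self,
      smul_apply]
    rw [norm_add_sq_real, real_inner_smul_right, norm_smul, Real.norm_of_nonneg hh, he,
      real_inner_comm]
    ring
  rw [h1]
  nlinarith [sq_nonneg (h * (⟪A e, e⟫ + h * ‖A e‖ ^ 2 / 2))]

theorem logMin_le_inner (A : E →L[ℝ] E) {e : E} (he : ‖e‖ = 1) :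
    logMin A ≤ ((⟪A e, e⟫ : ℝ) : EReal) := by
  have hlim : Tendsto (fun h : ℝ => ⟪A e, e⟫ + h * ‖A e‖ ^ 2 / 2) (𝓝[>] 0) (𝓝 ⟪A e, e⟫) := by
    have : Continuous fun h : ℝ => ⟪A e, e⟫ + h * ‖A e‖ ^ 2 / 2 := by fun_prop
    simpa using (this.tendsto 0).mono_left nhdsWithin_le_nhds
  have hpos : ∀ᶠ h : ℝ in 𝓝[>] 0, 0 < 1 + h * (⟪A e, e⟫ + h * ‖A e‖ ^ 2 / 2) := by
    have : Continuous fun h : ℝ => 1 + h * (⟪A e, e⟫ + h * ‖A e‖ ^ 2 / 2) := by fun_prop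
    refine nhdsWithin_le_nhds ((this.tendsto 0).eventually (lt_mem_nhds ?_))
    simp
  rw [← ((continuous_coe_real_ereal.tendsto _).comp hlim).limsup_eq]
  refine limsup_le_limsup ?_
  filter_upwards [self_mem_nhdsWithin, hpos] with h (hh : 0 < h) hp
  have h1 : minExpansion (1 + h • A) ≤ ((‖(1 + h • A) e‖ : ℝ) : EReal) := iInf₂_le e he
  have h2 := norm_one_add_smul_apply_le A he hh.le hp.le
  have h3 : minExpansion (1 + h • A) - 1 ≤ ((h * (⟪A e, e⟫ + h * ‖A e‖ ^ 2 / 2) : ℝ) : EReal) := by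
    refine (EReal.sub_le_sub h1 le_rfl).trans ?_
    rw [← EReal.coe_one, ← EReal.coe_sub, EReal.coe_le_coe_iff]
    linarith
  refine (EReal.div_le_div_right_of_nonneg (EReal.coe_nonneg.2 hh.le) h3).trans ?_
  rw [← EReal.coe_div, Function.comp_apply, mul_div_cancel_left₀ _ hh.ne']

theorem inner_le_of_logNorm_le {A : E →L[ℝ] E} {r : ℝ} (h : logNorm A ≤ r) (v : E) :
    ⟪A v, v⟫ ≤ r * ‖v‖ ^ 2 := by
  rcases eq_or_ne v 0 with rfl | hv
  · simp
  have hn : ‖v‖ ≠ 0 := norm_ne_zero_iff.2 hv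
  have h1 := EReal.coe_le_coe_iff.1
    ((inner_le_logNorm A (norm_smul_inv_norm (𝕜 := ℝ) hv)).trans h)
  simp only [map_smul, real_inner_smul_left, real_inner_smul_right, RCLike.ofReal_real_eq_id,
    id] at h1
  rw [← mul_assoc, ← mul_inv, inv_mul_le_iff₀ (by positivity)] at h1
  linarith

theorem le_inner_of_le_logMin {A : E →L[ℝ] E} {r : ℝ} (h : r ≤ logMin A) (v : E) :
    r * ‖v‖ ^ 2 ≤ ⟪A v, v⟫ := by
  rcases eq_or_ne v 0 with rfl | hv
  · simp
  have hn : ‖v‖ ≠ 0 := norm_ne_zero_iff.2 hv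
  have h1 := EReal.coe_le_coe_iff.1
    (h.trans (logMin_le_inner A (norm_smul_inv_norm (𝕜 := ℝ) hv)))
  simp only [map_smul, real_inner_smul_left, real_inner_smul_right, RCLike.ofReal_real_eq_id,
    id] at h1
  rw [← mul_assoc, ← mul_inv, le_inv_mul_iff₀ (by positivity)] at h1
  linarith

end LogarithmicNormBounds

/-! ### Partial derivatives and the mean value theorem -/

section PartialDerivatives

variable {nu ns k : ℕ} {f : (Euc nu × Euc ns) × Euc k → Euc nu × Euc ns}

theorem hasFDerivAt_section (hf : ContDiff ℝ ∞ f) (z : Euc nu × Euc ns) (μ : Euc k) :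
    HasFDerivAt (fun w => f (w, μ)) (fderiv ℝ (fun w => f (w, μ)) z) z := by
  have : ContDiff ℝ ∞ fun w => f (w, μ) := hf.comp (contDiff_id.prodMk contDiff_const)
  exact (this.differentiable (by simp) z).hasFDerivAt

theorem fderiv_section_fst (hf : ContDiff ℝ ∞ f) (z : Euc nu × Euc ns) (μ : Euc k)
    (d : Euc nu × Euc ns) :
    (fderiv ℝ (fun w => f (w, μ)) z d).1 = dfaa f z μ d.1 + dfab f z μ d.2 := by
  have h := (ContinuousLinearMap.fst ℝ (Euc nu) (Euc ns)).hasFDerivAt.comp z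
    (hasFDerivAt_section hf z μ)
  have ha : dfaa f z μ = _ := (HasFDerivAt.comp (f := fun a => (a, z.2)) z.1 h
    (hasFDerivAt_prodMk_left z.1 z.2)).fderiv
  have hb : dfab f z μ = _ := (HasFDerivAt.comp (f := fun b => (z.1, b)) z.2 h
    (hasFDerivAt_prodMk_right z.1 z.2)).fderiv
  rw [ha, hb]
  simp [← Prod.fst_add, ← map_add]

theorem fderiv_section_snd (hf : ContDiff ℝ ∞ f) (z : Euc nu × Euc ns) (μ : Euc k)
    (d : Euc nu × Euc ns) :
    (fderiv ℝ (fun w => f (w, μ)) z d).2 = dfba f z μ d.1 + dfbb f z μ d.2 := by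
  have h := (ContinuousLinearMap.snd ℝ (Euc nu) (Euc ns)).hasFDerivAt.comp z
    (hasFDerivAt_section hf z μ)
  have ha : dfba f z μ = _ := (HasFDerivAt.comp (f := fun a => (a, z.2)) z.1 h
    (hasFDerivAt_prodMk_left z.1 z.2)).fderiv
  have hb : dfbb f z μ = _ := (HasFDerivAt.comp (f := fun b => (z.1, b)) z.2 h
    (hasFDerivAt_prodMk_right z.1 z.2)).fderiv
  rw [ha, hb]
  simp [← Prod.snd_add, ← map_add]

/-- The partial derivative in the first variable of the `L²` product is dominated by the total
one. -/
theorem norm_fderiv_withLp_left_le {E G H : Type*} [NormedAddCommGroup E] [NormedSpace ℝ E]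
    [NormedAddCommGroup G] [NormedSpace ℝ G] [NormedAddCommGroup H] [NormedSpace ℝ H]
    {Φ : WithLp 2 (E × G) → H} {x : E} {y : G} (hΦ : DifferentiableAt ℝ Φ (WithLp.toLp 2 (x, y))) :
    ‖fderiv ℝ (fun x' => Φ (WithLp.toLp 2 (x', y))) x‖ ≤ ‖fderiv ℝ Φ (WithLp.toLp 2 (x, y))‖ := by
  let e := (WithLp.prodContinuousLinearEquiv 2 ℝ E G).symm
  have h1 : HasFDerivAt (fun x' : E => e (x', y))
      ((e : E × G →L[ℝ] WithLp 2 (E × G)).comp (ContinuousLinearMap.inl ℝ E G)) x :=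
    (e : E × G →L[ℝ] WithLp 2 (E × G)).hasFDerivAt.comp x (hasFDerivAt_prodMk_left x y)
  have h2 := HasFDerivAt.comp (g := Φ) (f := fun x' : E => e (x', y)) x hΦ.hasFDerivAt h1
  have h3 : fderiv ℝ (fun x' => Φ (WithLp.toLp 2 (x', y))) x = _ := h2.fderiv
  rw [h3]
  refine ContinuousLinearMap.opNorm_le_bound _ (norm_nonneg _) fun v => ?_
  refine ((fderiv ℝ Φ (WithLp.toLp 2 (x, y))).le_opNorm (e (v, 0))).trans_eq ?_
  congr 1
  change ‖WithLp.toLp 2 (v, (0 : G))‖ = ‖v‖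
  simp

theorem norm_dfab_le (hf : ContDiff ℝ ∞ f) (z : Euc nu × Euc ns) (μ : Euc k) :
    ‖dfab f z μ‖ ≤ ‖dfabμ f z μ‖ := by
  refine norm_fderiv_withLp_left_le (Φ := fun q : WithLp 2 (Euc ns × Euc k) =>
    (f ((z.1, q.fst), q.snd)).1) ?_
  have he : Differentiable ℝ (WithLp.prodContinuousLinearEquiv 2 ℝ (Euc ns) (Euc k)) :=
    ContinuousLinearEquiv.differentiable _
  have h : Differentiable ℝ fun q : Euc ns × Euc k => (f ((z.1, q.1), q.2)).1 :=
    ((hf.differentiable (by simp)).comp (by fun_prop :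
      Differentiable ℝ fun q : Euc ns × Euc k => ((z.1, q.1), q.2))).fst
  exact (h.comp he) _

theorem norm_dfba_le (hf : ContDiff ℝ ∞ f) (z : Euc nu × Euc ns) (μ : Euc k) :
    ‖dfba f z μ‖ ≤ ‖dfbaμ f z μ‖ := by
  refine norm_fderiv_withLp_left_le (Φ := fun q : WithLp 2 (Euc nu × Euc k) =>
    (f ((q.fst, z.2), q.snd)).2) ?_
  have he : Differentiable ℝ (WithLp.prodContinuousLinearEquiv 2 ℝ (Euc nu) (Euc k)) :=
    ContinuousLinearEquiv.differentiable _
  have h : Differentiable ℝ fun q : Euc nu × Euc k => (f ((q.1, z.2), q.2)).2 :=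
    ((hf.differentiable (by simp)).comp (by fun_prop :
      Differentiable ℝ fun q : Euc nu × Euc k => ((q.1, z.2), q.2))).snd
  exact (h.comp he) _

theorem unitBox_eq_closedBall : unitBox nu ns = Metric.closedBall 0 1 :=
  closedBall_prod_same _ _ _

/-- Pairing with a fixed `p` makes the function scalar, so one intermediate point `ζ` serves all
partial derivatives. This matters for `ξ_{u,W^u}`, whose terms are evaluated at a common point. -/
theorem exists_inner_fst_sub_eq (hf : ContDiff ℝ ∞ f) (μ : Euc k) {z w : Euc nu × Euc ns}
    (hz : z ∈ unitBox nu ns) (hw : w ∈ unitBox nu ns) (p : Euc nu) :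
    ∃ ζ ∈ unitBox nu ns, ⟪p, (f (z, μ)).1 - (f (w, μ)).1⟫ =
      ⟪p, dfaa f ζ μ (z.1 - w.1) + dfab f ζ μ (z.2 - w.2)⟫ := by
  have hconv : Convex ℝ (unitBox nu ns) := by
    rw [unitBox_eq_closedBall]; exact convex_closedBall _ _
  let ℓ := (innerSL ℝ p).comp (ContinuousLinearMap.fst ℝ (Euc nu) (Euc ns))
  have hd : ∀ v, HasFDerivAt (fun v => ⟪p, (f (v, μ)).1⟫)
      (ℓ.comp (fderiv ℝ (fun w => f (w, μ)) v)) v := fun v =>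
    HasFDerivAt.comp (g := ℓ) (f := fun w => f (w, μ)) v ℓ.hasFDerivAt (hasFDerivAt_section hf v μ)
  obtain ⟨ζ, hζ, h⟩ := domain_mvt (fun v _ => (hd v).hasFDerivWithinAt) hconv hw hz
  refine ⟨ζ, hconv.segment_subset hw hz hζ, ?_⟩
  rw [inner_sub_right, h, ← Prod.fst_sub, ← Prod.snd_sub, ← fderiv_section_fst hf]
  rfl

theorem exists_inner_snd_sub_eq (hf : ContDiff ℝ ∞ f) (μ : Euc k) {z w : Euc nu × Euc ns}
    (hz : z ∈ unitBox nu ns) (hw : w ∈ unitBox nu ns) (p : Euc ns) :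
    ∃ ζ ∈ unitBox nu ns, ⟪p, (f (z, μ)).2 - (f (w, μ)).2⟫ =
      ⟪p, dfba f ζ μ (z.1 - w.1) + dfbb f ζ μ (z.2 - w.2)⟫ := by
  have hconv : Convex ℝ (unitBox nu ns) := by
    rw [unitBox_eq_closedBall]; exact convex_closedBall _ _
  let ℓ := (innerSL ℝ p).comp (ContinuousLinearMap.snd ℝ (Euc nu) (Euc ns))
  have hd : ∀ v, HasFDerivAt (fun v => ⟪p, (f (v, μ)).2⟫)
      (ℓ.comp (fderiv ℝ (fun w => f (w, μ)) v)) v := fun v =>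
    HasFDerivAt.comp (g := ℓ) (f := fun w => f (w, μ)) v ℓ.hasFDerivAt (hasFDerivAt_section hf v μ)
  obtain ⟨ζ, hζ, h⟩ := domain_mvt (fun v _ => (hd v).hasFDerivWithinAt) hconv hw hz
  refine ⟨ζ, hconv.segment_subset hw hz hζ, ?_⟩
  rw [inner_sub_right, h, ← Prod.fst_sub, ← Prod.snd_sub, ← fderiv_section_snd hf]
  rfl

end PartialDerivatives

/-! ### From the rates to cone fields and growth -/

section Rates

variable {nu ns k : ℕ} {f : (Euc nu × Euc ns) × Euc k → Euc nu × Euc ns} {K : Set (Euc k)} {M : ℝ}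

/-- A real number strictly between `μ_s` and `0` serves as a uniform rate even if `μ_s = -∞`;
dropping the `μ`-derivative only decreases the norm. -/
theorem exists_inner_dfbb_le (hf : ContDiff ℝ ∞ f) (hM : 0 ≤ M) (h : rateMuS f K M < 0) :
    ∃ c : ℝ, 0 < c ∧ ∀ z ∈ unitBox nu ns, ∀ μ ∈ K, ∀ v,
      ⟪dfbb f z μ v, v⟫ ≤ (-c - M * ‖dfba f z μ‖) * ‖v‖ ^ 2 := by
  obtain ⟨r, hr, hr0⟩ := EReal.lt_iff_exists_real_btwn.1 h
  refine ⟨-r, by simpa using hr0, fun z hz μ hμ v => ?_⟩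
  have h1 : logNorm (dfbb f z μ) + ((M * ‖dfbaμ f z μ‖ : ℝ) : EReal) ≤ r :=
    (le_iSup₂_of_le (f := fun z _ => ⨆ μ ∈ K, (logNorm (dfbb f z μ) +
      ((M * ‖dfbaμ f z μ‖ : ℝ) : EReal))) z hz (le_iSup₂_of_le μ hμ le_rfl)).trans hr.le
  have h2 : logNorm (dfbb f z μ) ≤ ((r - M * ‖dfbaμ f z μ‖ : ℝ) : EReal) := by
    rw [EReal.coe_sub]
    exact (EReal.le_sub_iff_add_le (by simp) (by simp)).2 h1
  refine (inner_le_of_logNorm_le h2 v).trans ?_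
  have := mul_le_mul_of_nonneg_left (norm_dfba_le hf z μ) hM
  exact mul_le_mul_of_nonneg_right (by linarith) (by positivity)

theorem exists_le_inner_dfaa (hf : ContDiff ℝ ∞ f) (hM : 0 ≤ M) (h : 0 < rateXiU f K M) :
    ∃ c : ℝ, 0 < c ∧ ∀ z ∈ unitBox nu ns, ∀ μ ∈ K, ∀ v,
      (c + M * ‖dfab f z μ‖) * ‖v‖ ^ 2 ≤ ⟪dfaa f z μ v, v⟫ := by
  obtain ⟨r, hr0, hr⟩ := EReal.lt_iff_exists_real_btwn.1 h
  refine ⟨r, by simpa using hr0, fun z hz μ hμ v => ?_⟩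
  have h1 := EReal.add_le_of_le_sub hr.le
  have h2 : ((‖dfabμ f z μ‖ : ℝ) : EReal) ≤
      ⨆ z ∈ unitBox nu ns, ⨆ μ ∈ K, ((‖dfabμ f z μ‖ : ℝ) : EReal) :=
    le_iSup₂_of_le z hz (le_iSup₂_of_le μ hμ le_rfl)
  have h3 : (⨅ z ∈ unitBox nu ns, ⨅ μ ∈ K, logMin (dfaa f z μ)) ≤ logMin (dfaa f z μ) :=
    iInf₂_le_of_le z hz (iInf₂_le_of_le μ hμ le_rfl)
  have h4 : ((r + M * ‖dfab f z μ‖ : ℝ) : EReal) ≤ logMin (dfaa f z μ) := by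
    refine le_trans ?_ (h1.trans h3)
    rw [EReal.coe_add, EReal.coe_mul]
    gcongr
    exact (EReal.coe_le_coe_iff.2 (norm_dfab_le hf z μ)).trans h2
  exact le_inner_of_le_logMin h4 v

theorem le_inner_dfaa_of_le_rateXiUWu {κ : ℝ} (h : κ ≤ rateXiUWu f K M) {z : Euc nu × Euc ns}
    (hz : z ∈ unitBox nu ns) {μ : Euc k} (hμ : μ ∈ K) (v : Euc nu) :
    (κ + 1 / M ^ 2 * ‖dfaa f z μ‖ + (M ^ 2 + 1) / M ^ 3 * ‖dfab f z μ‖) * ‖v‖ ^ 2 ≤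
      ⟪dfaa f z μ v, v⟫ := by
  refine le_inner_of_le_logMin ?_ v
  have h1 : rateXiUWu f K M ≤ logMin (dfaa f z μ) -
      (((M ^ 2 + 1) / M ^ 3 * ‖dfab f z μ‖ : ℝ) : EReal) -
        ((1 / M ^ 2 * ‖dfaa f z μ‖ : ℝ) : EReal) :=
    iInf₂_le_of_le z hz (iInf₂_le_of_le μ hμ le_rfl)
  rw [EReal.coe_add, EReal.coe_add]
  exact EReal.add_le_of_le_sub (EReal.add_le_of_le_sub (h.trans h1))

/-- Inside each cone the off-diagonal term is at most `M` times its operator norm times the square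
of the dominant difference, exactly what `ξ_u` and `μ_s` subtract or add. -/
theorem exists_isConeField (hf : ContDiff ℝ ∞ f) (hM : 1 < M) (hcone : MConeCondition f K M)
    {μ : Euc k} (hμ : μ ∈ K) (h0 : f (0, μ) = 0) :
    ∃ (c : ℝ) (L : ℝ≥0), IsConeField (fun z => f (z, μ)) M c L := by
  have hM0 : 0 ≤ M := by linarith
  obtain ⟨c₁, hc₁, hs⟩ := exists_inner_dfbb_le hf hM0 hcone.muS_neg
  obtain ⟨c₂, hc₂, hu⟩ := exists_le_inner_dfaa hf hM0 hcone.xiU_pos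
  have hsec : ContDiff ℝ ∞ fun w => f (w, μ) := hf.comp (contDiff_id.prodMk contDiff_const)
  obtain ⟨L, hL⟩ := hsec.contDiffOn.exists_lipschitzOnWith (s := Metric.closedBall 0 1) (by simp)
    (convex_closedBall _ _) (isCompact_closedBall _ _)
  refine ⟨min c₁ c₂, L, hM, lt_min hc₁ hc₂, h0, hL, ?_, ?_⟩
  · intro z hz w hw hzw
    rw [← unitBox_eq_closedBall] at hz hw
    obtain ⟨ζ, hζ, h⟩ := exists_inner_fst_sub_eq hf μ hz hw (z.1 - w.1)
    rw [h, inner_add_right, real_inner_comm]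
    have h1 := hu ζ hζ μ hμ (z.1 - w.1)
    have h2 := neg_le_of_abs_le (abs_real_inner_le_norm (z.1 - w.1) (dfab f ζ μ (z.2 - w.2)))
    have h3 : ‖z.1 - w.1‖ * ‖dfab f ζ μ (z.2 - w.2)‖ ≤
        ‖z.1 - w.1‖ * (‖dfab f ζ μ‖ * (M * ‖z.1 - w.1‖)) :=
      mul_le_mul_of_nonneg_left (((dfab f ζ μ).le_opNorm _).trans
        (mul_le_mul_of_nonneg_left hzw (norm_nonneg _))) (norm_nonneg _)
    have h4 := mul_le_mul_of_nonneg_right (min_le_right c₁ c₂) (sq_nonneg ‖z.1 - w.1‖)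
    linarith
  · intro z hz w hw hzw
    rw [← unitBox_eq_closedBall] at hz hw
    obtain ⟨ζ, hζ, h⟩ := exists_inner_snd_sub_eq hf μ hz hw (z.2 - w.2)
    rw [h, inner_add_right, real_inner_comm (dfbb f ζ μ _)]
    have h1 := hs ζ hζ μ hμ (z.2 - w.2)
    have h2 := real_inner_le_norm (z.2 - w.2) (dfba f ζ μ (z.1 - w.1))
    have h3 : ‖z.2 - w.2‖ * ‖dfba f ζ μ (z.1 - w.1)‖ ≤
        ‖z.2 - w.2‖ * (‖dfba f ζ μ‖ * (M * ‖z.2 - w.2‖)) :=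
      mul_le_mul_of_nonneg_left (((dfba f ζ μ).le_opNorm _).trans
        (mul_le_mul_of_nonneg_left hzw (norm_nonneg _))) (norm_nonneg _)
    have h4 := mul_le_mul_of_nonneg_right (min_le_left c₁ c₂) (sq_nonneg ‖z.2 - w.2‖)
    linarith

/-- The growth of `‖a‖² + ‖b‖²` at a point of the cone `M ‖b‖ ≤ ‖a‖` where the velocity lies in the
same cone. -/
theorem le_inner_add_inner_of_cone (hf : ContDiff ℝ ∞ f) (hM : 1 < M) {κ : ℝ}
    (hκ : κ ≤ rateXiUWu f K M) {μ : Euc k} (hμ : μ ∈ K) (h0 : f (0, μ) = 0)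
    {z : Euc nu × Euc ns} (hz : z ∈ unitBox nu ns) (hcone : M * ‖z.2‖ ≤ ‖z.1‖)
    (hvel : M * ‖(f (z, μ)).2‖ ≤ ‖(f (z, μ)).1‖) :
    κ * ‖z.1‖ ^ 2 ≤ ⟪z.1, (f (z, μ)).1⟫ + ⟪z.2, (f (z, μ)).2⟫ := by
  have hM0 : 0 < M := by linarith
  have h0m : (0 : Euc nu × Euc ns) ∈ unitBox nu ns := by simp [unitBox_eq_closedBall]
  -- The direction of `f^a`, or `0` when `f^a = 0`; either way `⟪e, f^a⟫ = ‖f^a‖`.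
  set e : Euc nu := ‖(f (z, μ)).1‖⁻¹ • (f (z, μ)).1 with he
  have he1 : ‖e‖ ≤ 1 := by
    rw [he, norm_smul, norm_inv, norm_norm]
    exact inv_mul_le_one
  have hef : ⟪e, (f (z, μ)).1⟫ = ‖(f (z, μ)).1‖ := by
    rw [he, real_inner_smul_left, real_inner_self_eq_norm_sq]
    rcases eq_or_ne ‖(f (z, μ)).1‖ 0 with h | h
    · simp [h]
    · field_simp
  -- This `p` merges `⟪a, f^a⟫` with the bound `-‖a‖‖f^a‖/M²` for `⟪b, f^b⟫` into one pairing, so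
  -- the mean value theorem is used only once.
  set p : Euc nu := z.1 - (‖z.1‖ / M ^ 2) • e with hp
  obtain ⟨ζ, hζ, h⟩ := exists_inner_fst_sub_eq hf μ hz h0m p
  simp only [h0, Prod.fst_zero, Prod.snd_zero, sub_zero] at h
  have hb : ‖z.2‖ ≤ ‖z.1‖ / M := by rwa [le_div_iff₀' hM0]
  have hfb : ‖(f (z, μ)).2‖ ≤ ‖(f (z, μ)).1‖ / M := by rwa [le_div_iff₀' hM0]
  have hsnd : -(‖z.1‖ / M ^ 2 * ‖(f (z, μ)).1‖) ≤ ⟪z.2, (f (z, μ)).2⟫ := by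
    refine le_trans ?_ (neg_le_of_abs_le (abs_real_inner_le_norm _ _))
    rw [neg_le_neg_iff]
    calc ‖z.2‖ * ‖(f (z, μ)).2‖ ≤ ‖z.1‖ / M * (‖(f (z, μ)).1‖ / M) := by gcongr
      _ = _ := by field_simp
  have hfst : ⟪p, (f (z, μ)).1⟫ = ⟪z.1, (f (z, μ)).1⟫ - ‖z.1‖ / M ^ 2 * ‖(f (z, μ)).1‖ := by
    rw [hp, inner_sub_left, real_inner_smul_left, hef]
  set A := dfaa f ζ μ
  set B := dfab f ζ μ
  have hBb : ‖B z.2‖ ≤ ‖B‖ * (‖z.1‖ / M) := (B.le_opNorm _).trans (by gcongr)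
  have hAa : ‖A z.1‖ ≤ ‖A‖ * ‖z.1‖ := A.le_opNorm _
  have h1 := le_inner_dfaa_of_le_rateXiUWu hκ hζ hμ z.1
  have h2 : -(‖z.1‖ * (‖B‖ * (‖z.1‖ / M))) ≤ ⟪z.1, B z.2⟫ := by
    refine le_trans ?_ (neg_le_of_abs_le (abs_real_inner_le_norm _ _))
    rw [neg_le_neg_iff]
    gcongr
  have h3 : ⟪e, A z.1 + B z.2⟫ ≤ ‖A‖ * ‖z.1‖ + ‖B‖ * (‖z.1‖ / M) := by
    refine (real_inner_le_norm _ _).trans ((mul_le_of_le_one_left (norm_nonneg _) he1).trans ?_)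
    exact (norm_add_le _ _).trans (add_le_add hAa hBb)
  have h4 : ⟪p, A z.1 + B z.2⟫ = ⟪A z.1, z.1⟫ + ⟪z.1, B z.2⟫
      - ‖z.1‖ / M ^ 2 * ⟪e, A z.1 + B z.2⟫ := by
    rw [hp, inner_sub_left, real_inner_smul_left, inner_add_right z.1, real_inner_comm z.1]
  have h5 : ‖z.1‖ / M ^ 2 * ⟪e, A z.1 + B z.2⟫ ≤
      ‖z.1‖ / M ^ 2 * (‖A‖ * ‖z.1‖ + ‖B‖ * (‖z.1‖ / M)) := by gcongr
  -- The two losses in `‖B‖` add up to `1/M + 1/M³ = (M² + 1)/M³`.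
  have h6 : (κ + 1 / M ^ 2 * ‖A‖ + (M ^ 2 + 1) / M ^ 3 * ‖B‖) * ‖z.1‖ ^ 2
      - ‖z.1‖ * (‖B‖ * (‖z.1‖ / M)) - ‖z.1‖ / M ^ 2 * (‖A‖ * ‖z.1‖ + ‖B‖ * (‖z.1‖ / M)) =
      κ * ‖z.1‖ ^ 2 := by
    field_simp
    ring
  linarith

end Rates

/-! ### Transport by the change of coordinates -/

section Conjugacy

variable {X Y : Type*} [NormedAddCommGroup X] [NormedSpace ℝ X] [NormedAddCommGroup Y]
  [NormedSpace ℝ Y] {P : X ≃ₜ Y}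

theorem fderiv_symm_apply_fderiv_apply (hP : ContDiff ℝ ∞ P) (hP' : ContDiff ℝ ∞ P.symm) (z d : X) :
    fderiv ℝ P.symm (P z) (fderiv ℝ P z d) = d := by
  have h := ((hP'.differentiable (by simp)) (P z)).hasFDerivAt.comp z
    ((hP.differentiable (by simp)) z).hasFDerivAt
  have hid : P.symm ∘ P = id := funext P.symm_apply_apply
  rw [hid] at h
  exact DFunLike.congr_fun (h.unique (hasFDerivAt_id z)) d

theorem isIntegralCurveOn_conj (hP : ContDiff ℝ ∞ P) {g : X → X} {v : Y → Y} {B : Set X}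
    (hPF : ∀ z ∈ B, fderiv ℝ P z (g z) = v (P z)) {z : ℝ → X} {J : Set ℝ} (hm : MapsTo z J B)
    (hz : IsIntegralCurveOn z (fun _ => g) J) :
    IsIntegralCurveOn (fun t => P (z t)) (fun _ => v) J := fun t ht => by
  have h := ((hP.differentiable (by simp)) (z t)).hasFDerivAt.comp_hasDerivWithinAt t (hz t ht)
  rwa [hPF _ (hm ht)] at h

theorem isIntegralCurveOn_symm_conj (hP : ContDiff ℝ ∞ P) (hP' : ContDiff ℝ ∞ P.symm) {g : X → X}
    {v : Y → Y} {B : Set X} (hPF : ∀ z ∈ B, fderiv ℝ P z (g z) = v (P z)) {x : ℝ → Y} {J : Set ℝ}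
    (hm : MapsTo x J (P '' B)) (hx : IsIntegralCurveOn x (fun _ => v) J) :
    IsIntegralCurveOn (fun t => P.symm (x t)) (fun _ => g) J := fun t ht => by
  have h := ((hP'.differentiable (by simp)) (x t)).hasFDerivAt.comp_hasDerivWithinAt t (hx t ht)
  obtain ⟨z, hz, hzx⟩ := hm ht
  simp only [← hzx, ← hPF z hz, fderiv_symm_apply_fderiv_apply hP hP'] at h
  simpa [← hzx] using! h

theorem symm_mem_of_mem_image {X Y : Type*} [TopologicalSpace X] [TopologicalSpace Y] {P : X ≃ₜ Y}
    {B : Set X} {y : Y} (h : y ∈ P '' B) : P.symm y ∈ B := by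
  obtain ⟨z, hz, rfl⟩ := h
  rwa [P.symm_apply_apply]

end Conjugacy

/-! ### Unstable manifold as a graph and the Lyapunov function -/

/-- The difference quotients lie in a closed cone, hence so does their limit; accumulation at `t`
keeps the limit from being vacuous. -/
theorem mul_norm_snd_deriv_le {E G : Type*} [NormedAddCommGroup E] [InnerProductSpace ℝ E]
    [NormedAddCommGroup G] [InnerProductSpace ℝ G] {z : ℝ → E × G} {z' : E × G} {J : Set ℝ} {t M : ℝ}
    (hJ : AccPt t (𝓟 J)) (hz : HasDerivWithinAt z z' J t)
    (hcone : ∀ s ∈ J, M * ‖(z s).2 - (z t).2‖ ≤ ‖(z s).1 - (z t).1‖) :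
    M * ‖z'.2‖ ≤ ‖z'.1‖ := by
  have : (𝓝[J \ {t}] t).NeBot := accPt_principal_iff_nhdsWithin.1 hJ
  have h1 := (hasDerivWithinAt_iff_tendsto_slope.1 hz.prod_fst).norm
  have h2 := ((hasDerivWithinAt_iff_tendsto_slope.1 hz.prod_snd).norm).const_mul M
  refine le_of_tendsto_of_tendsto h2 h1 ?_
  filter_upwards [self_mem_nhdsWithin] with s hs
  simp only [slope_def_module, norm_smul]
  rw [mul_left_comm]
  exact mul_le_mul_of_nonneg_left (hcone s hs.1) (norm_nonneg _)

/-- The unstable manifold in the unit box consists of the points of trajectories that stay in the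
box for all negative times. -/
theorem unstableManifoldIn_image_eq {nu ns : ℕ} {g : Euc nu × Euc ns → Euc nu × Euc ns} {M c : ℝ}
    {L : ℝ≥0} (hg : IsConeField g M c L) {P : (Euc nu × Euc ns) ≃ₜ Euc (nu + ns)}
    (hP : ContDiff ℝ ∞ P) (hP' : ContDiff ℝ ∞ P.symm) {v : Euc (nu + ns) → Euc (nu + ns)}
    (hPF : ∀ z ∈ unitBox nu ns, fderiv ℝ P z (g z) = v (P z)) :
    unstableManifoldIn v (P 0) (P '' unitBox nu ns) =
      P '' {z₀ | ∃ z : ℝ → Euc nu × Euc ns, z 0 = z₀ ∧ IsIntegralCurveOn z (fun _ => g) (Iic 0) ∧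
        MapsTo z (Iic 0) (Metric.closedBall 0 1)} := by
  ext x₀
  constructor
  -- Convergence can be dropped: it follows from staying in the box, and is recovered that way in
  -- the converse.
  · rintro ⟨x, hx0, hx, hm, -⟩
    refine ⟨P.symm x₀, ⟨fun t => P.symm (x t), congrArg P.symm hx0,
      isIntegralCurveOn_symm_conj hP hP' hPF hm hx, fun t ht => ?_⟩, P.apply_symm_apply _⟩
    rw [← unitBox_eq_closedBall]
    exact symm_mem_of_mem_image (hm ht)
  · rintro ⟨z₀, ⟨z, hz0, hz, hm⟩, rfl⟩
    have hm' : MapsTo z (Iic 0) (unitBox nu ns) := by rwa [unitBox_eq_closedBall]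
    exact ⟨fun t => P (z t), congrArg P hz0, isIntegralCurveOn_conj hP hPF hm' hz,
      fun t ht => mem_image_of_mem _ (hm' ht),
      (P.continuous.tendsto 0).comp (hg.tendsto_zero_of_backward hz hm)⟩

/-- The growth of `‖a‖² + ‖σ a‖²` along a trajectory in the graph of `σ`. -/
theorem exists_hasDerivWithinAt_neg_lyapunovU {nu ns k : ℕ}
    {f : (Euc nu × Euc ns) × Euc k → Euc nu × Euc ns} {K : Set (Euc k)} {M : ℝ}
    (hf : ContDiff ℝ ∞ f) (hM : 1 < M) {μ : Euc k} (hμ : μ ∈ K) (h0 : f (0, μ) = 0)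
    {σ : Euc nu → Euc ns} (hσ0 : σ 0 = 0)
    (hσ : ∀ a a', ‖a‖ ≤ 1 → ‖a'‖ ≤ 1 → M * ‖σ a - σ a'‖ ≤ ‖a - a'‖)
    {J : Set ℝ} (hJ : J.OrdConnected) (hJ' : J.Nontrivial) {z : ℝ → Euc nu × Euc ns}
    (hz : IsIntegralCurveOn z (fun _ w => f (w, μ)) J) (hm : MapsTo z J (unitBox nu ns))
    (hgraph : ∀ t ∈ J, (z t).2 = σ (z t).1) {t : ℝ} (ht : t ∈ J) :
    ∃ D : ℝ, HasDerivWithinAt (fun s => -lyapunovU σ (z s)) D J t ∧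
      ∀ κ : ℝ, κ ≤ rateXiUWu f K M → κ * ‖(z t).1‖ ^ 2 ≤ 1 / 2 * D := by
  have hnorm : ∀ s ∈ J, ‖(z s).1‖ ≤ 1 := fun s hs => by
    have := hm hs
    rw [unitBox_eq_closedBall] at this
    exact (mem_closedBall_prod_zero.1 this).1
  have hcone : ∀ s ∈ J, M * ‖(z s).2 - (z t).2‖ ≤ ‖(z s).1 - (z t).1‖ := fun s hs => by
    rw [hgraph s hs, hgraph t ht]
    exact hσ _ _ (hnorm s hs) (hnorm t ht)
  have hcone0 : M * ‖(z t).2‖ ≤ ‖(z t).1‖ := by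
    have := hσ (z t).1 0 (hnorm t ht) (by simp)
    rwa [hσ0, sub_zero, sub_zero, ← hgraph t ht] at this
  have hvel := mul_norm_snd_deriv_le
    (hJ.isPreconnected.preperfect_of_nontrivial hJ' t ht) (hz t ht) hcone
  refine ⟨2 * ⟪(z t).1, (f (z t, μ)).1⟫ + 2 * ⟪(z t).2, (f (z t, μ)).2⟫, ?_, fun κ hκ => ?_⟩
  -- Along the orbit `σ a = b`, so `b` is differentiated instead of `σ`.
  · refine ((hz t ht).prod_fst.norm_sq.add (hz t ht).prod_snd.norm_sq).congr_of_mem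
      (fun s hs => ?_) ht
    simp only [lyapunovU, neg_neg, Pi.add_apply, hgraph s hs]
  · have := le_inner_add_inner_of_cone hf hM hκ hμ h0 (hm ht) hcone0 hvel
    linarith

/-- An infinite rate would force `⟪Aa, a⟫` above `‖A‖‖a‖²`. This disposes of the infinite case of
the final inequality. -/
theorem eq_zero_of_rateXiUWu_eq_top {nu ns k : ℕ} {f : (Euc nu × Euc ns) × Euc k → Euc nu × Euc ns}
    {K : Set (Euc k)} {M : ℝ} (h : rateXiUWu f K M = ⊤) {μ : Euc k} (hμ : μ ∈ K) (a : Euc nu) :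
    a = 0 := by
  have hz : (0 : Euc nu × Euc ns) ∈ unitBox nu ns := by simp [unitBox_eq_closedBall]
  by_contra ha
  have hn : 0 < ‖a‖ ^ 2 := by positivity
  set A := dfaa f 0 μ
  set s := 1 / M ^ 2 * ‖A‖ + (M ^ 2 + 1) / M ^ 3 * ‖dfab f 0 μ‖
  -- This `κ` makes the total coefficient `‖A‖ + 1`.
  have h1 := le_inner_dfaa_of_le_rateXiUWu (κ := ‖A‖ - s + 1) (by rw [h]; exact le_top) hz hμ a
  have h2 : ⟪A a, a⟫ ≤ ‖A‖ * ‖a‖ ^ 2 := by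
    refine (real_inner_le_norm _ _).trans ?_
    rw [pow_two, ← mul_assoc]
    exact mul_le_mul_of_nonneg_right (A.le_opNorm a) (norm_nonneg a)
  have h3 : (‖A‖ + 1) * ‖a‖ ^ 2 ≤ ⟪A a, a⟫ := by
    refine le_trans (le_of_eq ?_) h1
    simp only [s]
    ring
  linarith

/-- `F` is the vector field in the original variable `x`, `P μ` the change of coordinates
`(a, b) ↦ x` (the inverse of the chart of the `h`-set `N = P μ '' unitBox`), and
`f = (f^a, f^b)` the vector field in the coordinates `(a, b)`. -/
theorem proposition3p10 (nu ns k : ℕ) (K : Set (Euc k)) (hK : IsCompact K)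
    (f : (Euc nu × Euc ns) × Euc k → Euc nu × Euc ns) (hf : ContDiff ℝ ∞ f)
    (F : Euc (nu + ns) → Euc k → Euc (nu + ns))
    (P : Euc k → (Euc nu × Euc ns) ≃ₜ Euc (nu + ns))
    (hP : ∀ μ ∈ K, ContDiff ℝ ∞ (P μ)) (hP' : ∀ μ ∈ K, ContDiff ℝ ∞ (P μ).symm)
    (hPF : ∀ μ ∈ K, ∀ z ∈ unitBox nu ns, fderiv ℝ (P μ) z (f (z, μ)) = F (P μ z) μ)
    (xs : Euc k → Euc (nu + ns)) (hPxs : ∀ μ ∈ K, P μ (0, 0) = xs μ)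
    (hxs : ∀ μ ∈ K, F (xs μ) μ = 0)
    (M : ℝ) (hM : 1 < M) (hcone : MConeCondition f K M) (hrate : 0 < rateXiUWu f K M) :
    ∀ μ ∈ K, ∃ σ : Euc nu → Euc ns,
      MapsTo σ (Metric.closedBall 0 1) (Metric.closedBall 0 1) ∧
      LipschitzOnWith (1 / M).toNNReal σ (Metric.closedBall 0 1) ∧
      unstableManifoldIn (fun x => F x μ) (xs μ) (P μ '' unitBox nu ns) =
        (fun a => P μ (a, σ a)) '' Metric.closedBall 0 1 ∧
      IsLyapunovOn (fun x => F x μ) (xs μ)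
        (unstableManifoldIn (fun x => F x μ) (xs μ) (P μ '' unitBox nu ns))
        (fun x => lyapunovU σ ((P μ).symm x)) ∧
      ∀ (J : Set ℝ) (x : ℝ → Euc (nu + ns)), J.OrdConnected → J.Nontrivial →
        IsIntegralCurveOn x (fun _ y => F y μ) J →
        MapsTo x J (unstableManifoldIn (fun x => F x μ) (xs μ) (P μ '' unitBox nu ns)) →
        ∀ t ∈ J, ∃ D : ℝ,
          HasDerivWithinAt (fun s => -lyapunovU σ ((P μ).symm (x s))) D J t ∧
          ((M ^ 2 / (M ^ 2 + 1) : ℝ) : EReal) * rateXiUWu f K M *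
              ((-lyapunovU σ ((P μ).symm (x t)) : ℝ) : EReal) ≤ ((1 / 2 * D : ℝ) : EReal) := by
  intro μ hμ
  have hP0 : P μ 0 = xs μ := hPxs μ hμ
  have h0m : (0 : Euc nu × Euc ns) ∈ unitBox nu ns := by simp [unitBox_eq_closedBall]
  have h0 : f (0, μ) = 0 := by
    rw [← fderiv_symm_apply_fderiv_apply (hP μ hμ) (hP' μ hμ) 0 (f (0, μ)), hPF μ hμ 0 h0m, hP0,
      hxs μ hμ, map_zero]
  obtain ⟨c, L, hg⟩ := exists_isConeField hf hM hcone hμ h0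
  have hM0 : 0 < M := by linarith
  have hex : ∀ a : Euc nu, ∃ z : ℝ → Euc nu × Euc ns, ‖a‖ ≤ 1 → (z 0).1 = a ∧
      IsIntegralCurveOn z (fun _ w => f (w, μ)) (Iic 0) ∧
      MapsTo z (Iic 0) (Metric.closedBall 0 1) := by
    intro a
    by_cases ha : ‖a‖ ≤ 1
    · obtain ⟨z, hz⟩ := hg.exists_backward ha
      exact ⟨z, fun _ => hz⟩
    · exact ⟨0, fun h => absurd h ha⟩
  choose Z hZ using hex
  set σ : Euc nu → Euc ns := fun a => (Z a 0).2 with hσdef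
  have hZ0 : ∀ a, ‖a‖ ≤ 1 → Z a 0 = (a, σ a) := fun a ha => Prod.ext (hZ a ha).1 rfl
  have hσL : ∀ a a', ‖a‖ ≤ 1 → ‖a'‖ ≤ 1 → M * ‖σ a - σ a'‖ ≤ ‖a - a'‖ := by
    intro a a' ha ha'
    have := hg.cone_of_backward (hZ a ha).2.1 (hZ a' ha').2.1 (hZ a ha).2.2 (hZ a' ha').2.2
    rwa [(hZ a ha).1, (hZ a' ha').1] at this
  have hσ0 : σ 0 = 0 := by
    have h00 : ‖(0 : Euc nu)‖ ≤ 1 := by simp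
    have := hg.mul_norm_snd_le_of_backward (hZ 0 h00).2.1 (hZ 0 h00).2.2
    rw [(hZ 0 h00).1, norm_zero] at this
    exact norm_le_zero_iff.1 (nonpos_of_mul_nonpos_right this hM0)
  have hσm : MapsTo σ (Metric.closedBall 0 1) (Metric.closedBall 0 1) := fun a ha =>
    mem_closedBall_zero_iff.2
      (mem_closedBall_prod_zero.1 ((hZ a (mem_closedBall_zero_iff.1 ha)).2.2 self_mem_Iic)).2
  have hWu : unstableManifoldIn (fun x => F x μ) (xs μ) (P μ '' unitBox nu ns) =
      (fun a => P μ (a, σ a)) '' Metric.closedBall 0 1 := by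
    rw [← hP0, unstableManifoldIn_image_eq hg (hP μ hμ) (hP' μ hμ) (hPF μ hμ),
      show (fun a => P μ (a, σ a)) = P μ ∘ fun a => (a, σ a) from rfl, image_comp]
    congr 1
    ext z₀
    constructor
    · rintro ⟨z, rfl, hz, hm⟩
      have ha := (mem_closedBall_prod_zero.1 (hm self_mem_Iic)).1
      refine ⟨(z 0).1, mem_closedBall_zero_iff.2 ha, Prod.ext rfl ?_⟩
      -- Two backward orbits over the same `a` have `Δa = 0`, so the cone forces `Δb = 0`.
      have := hg.cone_of_backward (hZ _ ha).2.1 hz (hZ _ ha).2.2 hm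
      rw [(hZ _ ha).1, sub_self, norm_zero] at this
      exact sub_eq_zero.1 (norm_le_zero_iff.1 (nonpos_of_mul_nonpos_right this hM0))
    · rintro ⟨a, ha, rfl⟩
      rw [mem_closedBall_zero_iff] at ha
      exact ⟨Z a, hZ0 a ha, (hZ a ha).2⟩
  have hgrowth : ∀ (J : Set ℝ) (x : ℝ → Euc (nu + ns)), J.OrdConnected → J.Nontrivial →
      IsIntegralCurveOn x (fun _ y => F y μ) J →
      MapsTo x J (unstableManifoldIn (fun x => F x μ) (xs μ) (P μ '' unitBox nu ns)) →
      ∀ t ∈ J, ((P μ).symm (x t)).2 = σ ((P μ).symm (x t)).1 ∧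
        M * ‖((P μ).symm (x t)).2‖ ≤ ‖((P μ).symm (x t)).1‖ ∧
        ∃ D : ℝ, HasDerivWithinAt (fun s => -lyapunovU σ ((P μ).symm (x s))) D J t ∧
          ∀ κ : ℝ, κ ≤ rateXiUWu f K M → κ * ‖((P μ).symm (x t)).1‖ ^ 2 ≤ 1 / 2 * D := by
    intro J x hJ hJ' hx hxm t ht
    rw [hWu] at hxm
    have hsub : (fun a => P μ (a, σ a)) '' Metric.closedBall 0 1 ⊆ P μ '' unitBox nu ns := by
      rintro _ ⟨a, ha, rfl⟩
      exact mem_image_of_mem _ ⟨ha, hσm ha⟩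
    have hgr : ∀ s ∈ J, ((P μ).symm (x s)).2 = σ ((P μ).symm (x s)).1 := by
      intro s hs
      obtain ⟨a, -, hax⟩ := hxm hs
      simp only [← hax, Homeomorph.symm_apply_apply]
    have hbox : MapsTo (fun s => (P μ).symm (x s)) J (unitBox nu ns) := fun s hs =>
      symm_mem_of_mem_image (hsub (hxm hs))
    refine ⟨hgr t ht, ?_, exists_hasDerivWithinAt_neg_lyapunovU hf hM hμ h0 hσ0 hσL hJ hJ'
      (isIntegralCurveOn_symm_conj (hP μ hμ) (hP' μ hμ) (hPF μ hμ) (hxm.mono_right hsub) hx)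
      hbox hgr ht⟩
    have := hσL ((P μ).symm (x t)).1 0 (mem_closedBall_zero_iff.1 (hbox ht).1) (by simp)
    rwa [hσ0, sub_zero, sub_zero, ← hgr t ht] at this
  refine ⟨σ, hσm, LipschitzOnWith.of_dist_le_mul fun a ha a' ha' => ?_, hWu, ?_, ?_⟩
  · rw [Real.coe_toNNReal _ (by positivity), dist_eq_norm, dist_eq_norm, one_div,
      le_inv_mul_iff₀ hM0]
    exact hσL a a' (mem_closedBall_zero_iff.1 ha) (mem_closedBall_zero_iff.1 ha')
  · intro J x hJ hJ' hx hxm t ht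
    obtain ⟨-, hcone0, D, hD, hDκ⟩ := hgrowth J x hJ hJ' hx hxm t ht
    -- Any positive real below the possibly infinite rate gives the strict sign.
    obtain ⟨κ, hκ0, hκ⟩ := EReal.lt_iff_exists_real_btwn.1 hrate
    have hκ0' : 0 < κ := by simpa using hκ0
    have h1 := hDκ κ hκ.le
    have h2 : 0 ≤ κ * ‖((P μ).symm (x t)).1‖ ^ 2 := by positivity
    refine ⟨-D, by simpa only [Pi.neg_def, neg_neg] using hD.neg, by linarith, fun hD0 => ?_⟩
    have h3 : κ * ‖((P μ).symm (x t)).1‖ ^ 2 = 0 := by linarith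
    have h4 : ‖((P μ).symm (x t)).1‖ = 0 := by
      simpa [hκ0'.ne'] using h3
    rw [h4] at hcone0
    have h5 : ((P μ).symm (x t)) = 0 := Prod.ext (norm_eq_zero.1 h4)
      (norm_le_zero_iff.1 (nonpos_of_mul_nonpos_right hcone0 hM0))
    rw [← hP0, ← h5, Homeomorph.apply_symm_apply]
  · intro J x hJ hJ' hx hxm t ht
    obtain ⟨hgr, hcone0, D, hD, hDκ⟩ := hgrowth J x hJ hJ' hx hxm t ht
    refine ⟨D, hD, ?_⟩
    set z := (P μ).symm (x t)
    have hlyap : -lyapunovU σ z = ‖z.1‖ ^ 2 + ‖z.2‖ ^ 2 := by rw [lyapunovU, neg_neg, hgr]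
    rw [hlyap]
    induction hrt : rateXiUWu f K M with
    | bot => rw [hrt] at hrate; simp at hrate
    | top =>
      have hz1 : z.1 = 0 := eq_zero_of_rateXiUWu_eq_top hrt hμ _
      have hz2 : z.2 = 0 := by rw [hgr, hz1, hσ0]
      have := hDκ 0 (by rw [hrt]; exact le_top)
      have hzero : ((‖z.1‖ ^ 2 + ‖z.2‖ ^ 2 : ℝ) : EReal) = 0 := by simp [hz1, hz2]
      -- In `EReal`, `⊤ * 0 = 0`, so only `0 ≤ D/2` remains.
      rw [hzero, mul_zero]
      exact EReal.coe_nonneg.2 (by linarith)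
    | coe κ =>
      rw [hrt] at hrate
      have hκ0 : 0 < κ := by simpa using hrate
      have h1 := hDκ κ hrt.ge
      rw [← EReal.coe_mul, ← EReal.coe_mul, EReal.coe_le_coe_iff]
      refine le_trans ?_ h1
      -- Hence `M²(‖a‖² + ‖b‖²) ≤ (M² + 1)‖a‖²`, the source of the factor `M²/(M² + 1)`.
      have h2 : M ^ 2 * ‖z.2‖ ^ 2 ≤ ‖z.1‖ ^ 2 := by
        rw [← mul_pow]
        exact pow_le_pow_left₀ (by positivity) hcone0 2
      rw [div_mul_eq_mul_div, div_mul_eq_mul_div, div_le_iff₀ (by positivity)]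
      linarith [mul_le_mul_of_nonneg_left h2 hκ0.le]
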